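/- Let $G$ be a finite group. A (right) action of $G$ on an additive category $\mathcal{A}$ consists of autoequivalences $F_g$ ($g\in G$) of $\mathcal{A}$ and natural isomorphisms $\delta_{g,h}\colon F_gF_h\to F_{hg}$ such that $\delta_{g,lh}\circ F_g\delta_{h,l}=\delta_{hg,l}\circ\delta_{g,h}F_l$ for all $g,h,l\in G$. The category $\mathcal{A}^G$ of equivariant objects has as objects the pairs $(X,\{\lambda_g\}_{g\in G})$ with $X\in\mathcal{A}$ and isomorphisms $\lambda_g\colon F_gX\to X$ satisfying $\lambda_g\circ F_g(\lambda_h)=\lambda_{hg}\circ\delta_{g,h,X}$, and as morphisms $(X,\{\lambda_g\})\to(Y,\{\mu_g\})$ the morphisms $f\colon X\to Y$ with $\mu_g\circ F_g(f)=f\circ\lambda_g$ for all $g$; let $\omega\colon\mathcal{A}^G\to\mathcal{A}$ be the forgetful functor. A functor $\Phi\colon\mathcal{A}\to\mathcal{B}$ between categories with $G$-actions $\{M_g,\alpha_{g,h}\}$, $\{N_g,\beta_{g,h}\}$ is made $G$-equivariant by natural isomorphisms $\varphi_g\colon\Phi M_g\to N_g\Phi$ with $\varphi_{hg}\circ\Phi\alpha_{g,h}=\beta_{g,h}\Phi\circ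 N_g\varphi_h\circ\varphi_gM_h$; it then induces $\Phi^G\colon\mathcal{A}^G\to\mathcal{B}^G$, $(X,\{\lambda_g\})\mapsto(\Phi X,\{\Phi(\lambda_g)\circ\varphi_{g,X}^{-1}\})$. An action of $G$ on a triangulated category $\mathcal{D}$ is admissible if the $F_g$ are exact, with commutation isomorphisms $\theta_g\colon F_g\circ[1]\to[1]\circ F_g$ such that $\{\theta_g^{-1}\}$ makes $[1]$ a $G$-equivariant functor. Then $[1]$ induces a translation functor on $\mathcal{D}^G$, and a canonical triangulated structure on $\mathcal{D}^G$ is a triangulated structure with this translation functor for which $\omega$ is exact (with the identity $\omega\circ[1]=[1]\circ\omega$ as commutation isomorphism). An integer $n$ is invertible in $\mathcal{D}$ if for each morphism $f$ of $\mathcal{D}$ there is a unique morphism $g$ with $ng=f$. A functor is an equivalence up to retracts if it is fully faithful and each object of its target is a retract of an object in its essential image. Suppose that $\mathcal{D}$ is a triangulated category with an admissible $G$-action, that $|G|$ is invertible in $\mathcal{D}$, and that $\mathcal{D}^G$ admits a canonical triangulated structure. Let $\mathcal{C}$ be a strictly full triangulated subcategory of $\mathcal{D}$ with $F_g(\mathcal{C})\subseteq\mathcal{C}$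 for all $g\in G$, let $Q\colon\mathcal{D}\to\mathcal{D}/\mathcal{C}$ be the Verdier quotient, and let $\mathcal{C}^G=\omega^{-1}(\mathcal{C})\subseteq\mathcal{D}^G$. Then: (1) The Verdier quotient $\mathcal{D}/\mathcal{C}$ carries an induced admissible $G$-action, that is, an admissible action for which $Q$ is $G$-equivariant by natural isomorphisms $\varphi_g$ compatible with the commutation isomorphisms with the translation functors. For every such induced action, $(\mathcal{D}/\mathcal{C})^G$ admits a unique canonical triangulated structure. (2) For every such induced action, the natural functor $\mathcal{D}^G/\mathcal{C}^G\to(\mathcal{D}/\mathcal{C})^G$ induced by $Q^G$ is exact with respect to the canonical triangulated structures, and is an equivalence up to retracts. If $\mathcal{D}^G/\mathcal{C}^G$ is idempotent-complete, it is an (exact) equivalence. -/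

import Mathlib

open CategoryTheory CategoryTheory.Limits CategoryTheory.Pretriangulated

universe w v u v' u'

namespace EquivTri

/-- A (right) action of a group `G` on an additive category: autoequivalences `F_g` together with
natural isomorphisms `δ_{g,h} : F_g F_h ≅ F_{hg}` subject to the 2-cocycle condition.
The isomorphism `δ_{g,h}` is written `A.δ e` with `e : h * g = k` and target `F_k`, so that the
cocycle condition can be stated without transport along associativity of `G`. -/
structure GroupAction (G : Type w) [Group G] (𝒜 : Type u) [Category.{v} 𝒜] [Preadditive 𝒜] where
  /-- the autoequivalences `F_g` -/
  F : G → 𝒜 ⥤ 𝒜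
  isEquivalence : ∀ g, (F g).IsEquivalence
  additive : ∀ g, (F g).Additive
  /-- the isomorphisms `δ_{g,h} : F_g F_h ≅ F_{hg}` -/
  δ : ∀ {g h k : G}, h * g = k → (F h ⋙ F g ≅ F k)
  cocycle : ∀ {g h l hg lh lhg : G} (e₁ : l * h = lh) (e₂ : lh * g = lhg)
    (e₃ : h * g = hg) (e₄ : l * hg = lhg) (X : 𝒜),
    (F g).map ((δ e₁).hom.app X) ≫ (δ e₂).hom.app X =
      (δ e₃).hom.app ((F l).obj X) ≫ (δ e₄).hom.app X

attribute [instance] GroupAction.isEquivalence GroupAction.additive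

section Equivariantization

variable {G : Type w} [Group G] {𝒜 : Type u} [Category.{v} 𝒜] [Preadditive 𝒜]

/-- A `G`-equivariant object: an object `X` with isomorphisms `λ_g : F_g X ≅ X` such that
`λ_g ∘ F_g(λ_h) = λ_{hg} ∘ δ_{g,h}`. -/
structure Equivariant (A : GroupAction G 𝒜) where
  /-- the underlying object -/
  obj : 𝒜
  /-- the equivariant structure -/
  lam : ∀ g : G, (A.F g).obj obj ≅ obj
  comm : ∀ {g h k : G} (e : h * g = k),
    (A.F g).map (lam h).hom ≫ (lam g).hom = (A.δ e).hom.app obj ≫ (lam k).hom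

variable {A : GroupAction G 𝒜}

/-- A morphism of equivariant objects: a morphism `f` of the underlying objects that is fixed by
`G`, i.e. `λ_g^Y ∘ F_g(f) ∘ (λ_g^X)⁻¹ = f`. -/
@[ext]
structure Equivariant.Hom (X Y : Equivariant A) where
  /-- the underlying morphism -/
  hom : X.obj ⟶ Y.obj
  comm : ∀ g : G, (A.F g).map hom ≫ (Y.lam g).hom = (X.lam g).hom ≫ hom

attribute [simp] Equivariant.Hom.comm

instance : Category (Equivariant A) where
  Hom X Y := Equivariant.Hom X Y
  id X := { hom := 𝟙 X.obj, comm := by simp }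
  comp {X Y Z} f g :=
    { hom := f.hom ≫ g.hom
      comm := fun a => by
        rw [Functor.map_comp, Category.assoc, g.comm, ← Category.assoc, f.comm, Category.assoc] }

namespace Equivariant

@[ext]
lemma hom_ext {X Y : Equivariant A} {f g : X ⟶ Y} (h : f.hom = g.hom) : f = g :=
  Hom.ext h

@[simp] lemma id_hom (X : Equivariant A) : Hom.hom (𝟙 X) = 𝟙 X.obj := rfl

@[simp] lemma comp_hom {X Y Z : Equivariant A} (f : X ⟶ Y) (g : Y ⟶ Z) :
    (f ≫ g).hom = f.hom ≫ g.hom := rfl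

lemma eqToHom_hom {X Y : Equivariant A} (h : X = Y) :
    (eqToHom h).hom = eqToHom (congrArg obj h) := by
  subst h; rfl

/-- An isomorphism of the underlying objects that is equivariant is an isomorphism. -/
@[simps]
def isoMk {X Y : Equivariant A} (e : X.obj ≅ Y.obj)
    (h : ∀ g : G, (A.F g).map e.hom ≫ (Y.lam g).hom = (X.lam g).hom ≫ e.hom) : X ≅ Y where
  hom := { hom := e.hom, comm := h }
  inv :=
    { hom := e.inv
      comm := fun g => by
        rw [← cancel_mono e.hom, Category.assoc, Category.assoc, ← h g, ← Functor.map_comp_assoc]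
        simp }

instance : Preadditive (Equivariant A) where
  homGroup X Y :=
    letI : Zero (X ⟶ Y) := ⟨{ hom := 0, comm := by simp }⟩
    letI : Add (X ⟶ Y) := ⟨fun f g =>
      { hom := f.hom + g.hom
        comm := by simp [Functor.map_add, Preadditive.add_comp, Preadditive.comp_add] }⟩
    letI : Neg (X ⟶ Y) := ⟨fun f =>
      { hom := -f.hom
        comm := by simp [Functor.map_neg, Preadditive.neg_comp, Preadditive.comp_neg] }⟩
    letI : Sub (X ⟶ Y) := ⟨fun f g =>
      { hom := f.hom - g.hom
        comm := by simp [Functor.map_sub, Preadditive.sub_comp, Preadditive.comp_sub] }⟩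
    letI : SMul ℕ (X ⟶ Y) := ⟨fun n f =>
      { hom := n • f.hom
        comm := by simp }⟩
    letI : SMul ℤ (X ⟶ Y) := ⟨fun n f =>
      { hom := n • f.hom
        comm := by simp }⟩
    Function.Injective.addCommGroup (fun f : X ⟶ Y => f.hom) (fun _ _ h => hom_ext h)
      rfl (fun _ _ => rfl) (fun _ => rfl) (fun _ _ => rfl) (fun _ _ => rfl) (fun _ _ => rfl)
  add_comp _ _ _ _ _ _ := hom_ext (Preadditive.add_comp _ _ _ _ _ _)
  comp_add _ _ _ _ _ _ := hom_ext (Preadditive.comp_add _ _ _ _ _ _)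

@[simp] lemma zero_hom (X Y : Equivariant A) : Hom.hom (0 : X ⟶ Y) = 0 := rfl

@[simp] lemma add_hom {X Y : Equivariant A} (f g : X ⟶ Y) : (f + g).hom = f.hom + g.hom := rfl

/-- The equivariant structure on a zero object. -/
noncomputable def zeroObj (A : GroupAction G 𝒜) [HasZeroObject 𝒜] : Equivariant A where
  obj := HasZeroObject.zero' 𝒜 |>.zero
  lam g := ((A.F g).map_isZero (isZero_zero 𝒜)).iso (isZero_zero 𝒜)
  comm _ := (isZero_zero 𝒜).eq_of_tgt _ _

instance [HasZeroObject 𝒜] : HasZeroObject (Equivariant A) where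
  zero := ⟨zeroObj A, by
    rw [IsZero.iff_id_eq_zero]
    exact hom_ext ((isZero_zero 𝒜).eq_of_tgt _ _)⟩

end Equivariant

/-- The forgetful functor `ω` from equivariant objects. -/
@[simps]
def forget (A : GroupAction G 𝒜) : Equivariant A ⥤ 𝒜 where
  obj X := X.obj
  map f := f.hom

instance (A : GroupAction G 𝒜) : (forget A).Faithful where
  map_injective h := Equivariant.hom_ext h

instance (A : GroupAction G 𝒜) : (forget A).Additive where

instance (A : GroupAction G 𝒜) : (forget A).ReflectsIsomorphisms where
  reflects {X Y} f hf := by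
    have : IsIso f.hom := hf
    exact (Equivariant.isoMk (asIso f.hom) f.comm).isIso_hom

end Equivariantization

section Shift

variable {G : Type w} [Group G] {𝒟 : Type u} [Category.{v} 𝒟] [Preadditive 𝒟] [HasShift 𝒟 ℤ]

/-- Commutation isomorphisms `θ_g : F_g ∘ [n] ≅ [n] ∘ F_g` of the functors of an action with the
shift, such that the isomorphisms `δ_{g,h}` commute with them; equivalently, the inverses
`θ_g⁻¹` make the translation functor `G`-equivariant. -/
class GroupAction.ShiftStructure (A : GroupAction G 𝒟) where
  commShift : ∀ g, (A.F g).CommShift ℤ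
  commShift_δ : ∀ {g h k : G} (e : h * g = k), NatTrans.CommShift (A.δ e).hom ℤ

variable (A : GroupAction G 𝒟) [A.ShiftStructure]

instance (g : G) : (A.F g).CommShift ℤ := GroupAction.ShiftStructure.commShift g

instance {g h k : G} (e : h * g = k) : NatTrans.CommShift (A.δ e).hom ℤ :=
  GroupAction.ShiftStructure.commShift_δ e

namespace Equivariant

/-- The shift of an equivariant object, with the structure
`F_g(X[n]) ≅ (F_g X)[n] ≅ X[n]`. -/
@[simps]
def shiftObj (n : ℤ) (X : Equivariant A) : Equivariant A where
  obj := X.obj⟦n⟧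
  lam g := ((A.F g).commShiftIso n).app X.obj ≪≫ (shiftFunctor 𝒟 n).mapIso (X.lam g)
  comm {g h k} e := by
    have h₁ := NatTrans.shift_app_comm (A.δ e).hom n X.obj
    rw [Functor.commShiftIso_comp_hom_app] at h₁
    have h₂ := congrArg (shiftFunctor 𝒟 n).map (X.comm e)
    simp only [Functor.map_comp] at h₂
    simp only [Iso.trans_hom, Iso.app_hom, Functor.mapIso_hom, Functor.map_comp, Category.assoc]
    rw [← reassoc_of% h₁, ← h₂, Functor.commShiftIso_hom_naturality_assoc]

lemma shiftObj_lam_hom (n : ℤ) (X : Equivariant A) (g : G) :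
    ((shiftObj A n X).lam g).hom =
      ((A.F g).commShiftIso n).hom.app X.obj ≫ ((X.lam g).hom)⟦n⟧' := rfl

/-- The shift functors on equivariant objects. -/
@[simps]
def shift (n : ℤ) : Equivariant A ⥤ Equivariant A where
  obj X := shiftObj A n X
  map f :=
    { hom := f.hom⟦n⟧'
      comm := fun g => by
        change (A.F g).map (f.hom⟦n⟧') ≫ ((A.F g).commShiftIso n).hom.app _ ≫ _ =
          (((A.F g).commShiftIso n).hom.app _ ≫ ((Equivariant.lam _ g).hom)⟦n⟧') ≫ f.hom⟦n⟧'
        rw [Functor.commShiftIso_hom_naturality_assoc, Category.assoc]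
        simp only [Functor.mapIso_hom, ← Functor.map_comp, f.comm] }

/-- Shifting by zero is the identity on equivariant objects. -/
def shiftZero : shift A 0 ≅ 𝟭 _ :=
  NatIso.ofComponents
    (fun X => isoMk ((shiftFunctorZero 𝒟 ℤ).app X.obj) (fun g => by
      change _ = (((A.F g).commShiftIso 0).hom.app X.obj ≫ ((X.lam g).hom)⟦(0 : ℤ)⟧') ≫
        (shiftFunctorZero 𝒟 ℤ).hom.app X.obj
      have h := (shiftFunctorZero 𝒟 ℤ).hom.naturality (X.lam g).hom
      dsimp at h
      rw [Category.assoc, h, Functor.commShiftIso_zero, Functor.CommShift.isoZero_hom_app,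
        Category.assoc, Iso.inv_hom_id_app_assoc]
      rfl))
    (fun f => hom_ext ((shiftFunctorZero 𝒟 ℤ).hom.naturality f.hom))

/-- Shifting by `n + m` is shifting by `n` and then by `m` on equivariant objects. -/
def shiftAdd (n m : ℤ) : shift A (n + m) ≅ shift A n ⋙ shift A m :=
  NatIso.ofComponents
    (fun X => isoMk ((shiftFunctorAdd 𝒟 n m).app X.obj) (fun g => by
      change (A.F g).map ((shiftFunctorAdd 𝒟 n m).hom.app X.obj) ≫
          ((A.F g).commShiftIso m).hom.app (X.obj⟦n⟧) ≫
            (((A.F g).commShiftIso n).hom.app X.obj ≫ ((X.lam g).hom)⟦n⟧')⟦m⟧' =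
        (((A.F g).commShiftIso (n + m)).hom.app X.obj ≫ ((X.lam g).hom)⟦n + m⟧') ≫
          (shiftFunctorAdd 𝒟 n m).hom.app X.obj
      have h := (shiftFunctorAdd 𝒟 n m).hom.naturality (X.lam g).hom
      dsimp at h
      rw [Category.assoc, h, Functor.commShiftIso_add, Functor.CommShift.isoAdd_hom_app]
      simp only [Category.assoc, Iso.inv_hom_id_app_assoc, Functor.map_comp]))
    (fun f => hom_ext ((shiftFunctorAdd 𝒟 n m).hom.naturality f.hom))

instance : HasShift (Equivariant A) ℤ :=
  hasShiftMk _ _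
    { F := shift A
      zero := shiftZero A
      add := shiftAdd A
      assoc_hom_app := fun m₁ m₂ m₃ X => by
        ext
        simp only [comp_hom, eqToHom_hom]
        have h := NatTrans.congr_app (congrArg Iso.hom (shiftFunctorAdd_assoc 𝒟 m₁ m₂ m₃)) X.obj
        simp only [shiftFunctorAdd', Iso.trans_hom, NatTrans.comp_app, eqToIso.hom, eqToHom_app,
          Functor.isoWhiskerRight_hom, Functor.whiskerRight_app, Functor.isoWhiskerLeft_hom,
          Functor.whiskerLeft_app, Functor.associator_hom_app, Category.comp_id,
          Category.assoc] at h
        exact h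
      zero_add_hom_app := fun n X => by
        ext
        simp only [comp_hom, eqToHom_hom]
        exact shiftFunctorAdd_zero_add_hom_app n X.obj
      add_zero_hom_app := fun n X => by
        ext
        simp only [comp_hom, eqToHom_hom]
        exact shiftFunctorAdd_add_zero_hom_app n X.obj }

instance [∀ n : ℤ, (shiftFunctor 𝒟 n).Additive] (n : ℤ) :
    (shiftFunctor (Equivariant A) n).Additive where
  map_add {_ _ f g} := hom_ext ((shiftFunctor 𝒟 n).map_add (f := f.hom) (g := g.hom))

end Equivariant

/-- The forgetful functor commutes strictly with the shifts. -/
instance : (forget A).CommShift ℤ where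
  commShiftIso n := NatIso.ofComponents (fun X => Iso.refl (X.obj⟦n⟧)) (fun f => by
    change f.hom⟦n⟧' ≫ 𝟙 _ = 𝟙 _ ≫ f.hom⟦n⟧'
    simp)
  commShiftIso_zero := by
    ext X
    rw [Functor.CommShift.isoZero_hom_app]
    exact ((shiftFunctorZero 𝒟 ℤ).hom_inv_id_app X.obj).symm
  commShiftIso_add n m := by
    ext X
    rw [Functor.CommShift.isoAdd_hom_app]
    change 𝟙 _ = (shiftFunctorAdd 𝒟 n m).hom.app X.obj ≫ 𝟙 _ ≫ (𝟙 (X.obj⟦n⟧))⟦m⟧' ≫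
      (shiftFunctorAdd 𝒟 n m).inv.app X.obj
    rw [CategoryTheory.Functor.map_id]
    refine Eq.trans ?_ (congrArg (_ ≫ ·)
      ((Category.id_comp _).trans (Category.id_comp _)).symm)
    exact ((shiftFunctorAdd 𝒟 n m).hom_inv_id_app X.obj).symm

end Shift

section EquivariantFunctor

variable {G : Type w} [Group G] {𝒜 : Type u} [Category.{v} 𝒜] [Preadditive 𝒜]
  {ℬ : Type u'} [Category.{v'} ℬ] [Preadditive ℬ]

/-- A `G`-equivariant structure on a functor `Φ : 𝒜 ⥤ ℬ` between categories with `G`-actions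
`(M_g, α)` and `(N_g, β)`: isomorphisms `φ_g : Φ M_g ≅ N_g Φ` compatible with `α` and `β`.
(Compatibility with the units of the two actions follows from the square for `g = h = 1`.) -/
structure EquivariantStructure (A : GroupAction G 𝒜) (B : GroupAction G ℬ) (Φ : 𝒜 ⥤ ℬ) where
  /-- the isomorphisms `φ_g : Φ M_g ≅ N_g Φ` -/
  φ : ∀ g : G, A.F g ⋙ Φ ≅ Φ ⋙ B.F g
  comm : ∀ {g h k : G} (e : h * g = k) (X : 𝒜),
    Φ.map ((A.δ e).hom.app X) ≫ (φ k).hom.app X =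
      (φ g).hom.app ((A.F h).obj X) ≫ (B.F g).map ((φ h).hom.app X) ≫ (B.δ e).hom.app (Φ.obj X)

variable {A : GroupAction G 𝒜} {B : GroupAction G ℬ} {Φ : 𝒜 ⥤ ℬ}

namespace EquivariantStructure

/-- The functor `Φ^G` on equivariant objects, `(X, λ_g) ↦ (Φ X, Φ(λ_g) ∘ φ_g⁻¹)`. -/
@[simps]
def map (S : EquivariantStructure A B Φ) : Equivariant A ⥤ Equivariant B where
  obj X :=
    { obj := Φ.obj X.obj
      lam := fun g => ((S.φ g).app X.obj).symm ≪≫ Φ.mapIso (X.lam g)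
      comm := fun {g h k} e => by
        have h₁ := S.comm e X.obj
        have h₂ := congrArg Φ.map (X.comm e)
        have h₃ := (S.φ g).inv.naturality (X.lam h).hom
        simp only [Functor.map_comp, Functor.comp_map] at h₂ h₃
        simp only [Iso.trans_hom, Iso.symm_hom, Iso.app_inv, Functor.mapIso_hom, Functor.map_comp,
          Category.assoc]
        rw [reassoc_of% h₃, h₂, ← cancel_epi ((B.F g).map ((S.φ h).hom.app X.obj)),
          ← cancel_epi ((S.φ g).hom.app ((A.F h).obj X.obj)), ← reassoc_of% h₁]
        simp [← Functor.map_comp_assoc] }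
  map {X Y} f :=
    { hom := Φ.map f.hom
      comm := fun g => by
        have h₃ := (S.φ g).inv.naturality f.hom
        simp only [Functor.comp_map] at h₃
        simp only [Iso.trans_hom, Iso.symm_hom, Iso.app_inv, Functor.mapIso_hom, Category.assoc]
        rw [reassoc_of% h₃, ← Φ.map_comp, ← Φ.map_comp, f.comm] }

/-- Compatibility of an equivariant structure with shifts: the `φ_g` commute with the
commutation isomorphisms of all the functors involved. -/
class CommShift [HasShift 𝒜 ℤ] [HasShift ℬ ℤ] [A.ShiftStructure] [B.ShiftStructure]
    [Φ.CommShift ℤ] (S : EquivariantStructure A B Φ) : Prop where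
  commShift_φ : ∀ g : G, NatTrans.CommShift (S.φ g).hom ℤ

/-- If `φ` is compatible with shifts, then `Φ^G` commutes with shifts, through the commutation
isomorphisms of `Φ`. -/
instance [HasShift 𝒜 ℤ] [HasShift ℬ ℤ] [A.ShiftStructure] [B.ShiftStructure]
    [Φ.CommShift ℤ] (S : EquivariantStructure A B Φ) [S.CommShift] : S.map.CommShift ℤ where
  commShiftIso n := NatIso.ofComponents
    (fun X => Equivariant.isoMk ((Φ.commShiftIso n).app X.obj) (fun g => by
      have := CommShift.commShift_φ (S := S) g
      have h₁ := NatTrans.shift_app_comm (S.φ g).hom n X.obj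
      rw [Functor.commShiftIso_comp_hom_app, Functor.commShiftIso_comp_hom_app] at h₁
      change (B.F g).map ((Φ.commShiftIso n).hom.app X.obj) ≫
          ((B.F g).commShiftIso n).hom.app (Φ.obj X.obj) ≫
            ((S.φ g).inv.app X.obj ≫ Φ.map (X.lam g).hom)⟦n⟧' =
        ((S.φ g).inv.app (X.obj⟦n⟧) ≫
          Φ.map (((A.F g).commShiftIso n).hom.app X.obj ≫ (X.lam g).hom⟦n⟧')) ≫
            (Φ.commShiftIso n).hom.app X.obj
      rw [← cancel_epi ((S.φ g).hom.app (X.obj⟦n⟧))]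
      simp only [Category.assoc] at h₁
      simp only [Functor.map_comp, Category.assoc, Iso.hom_inv_id_app_assoc,
        Functor.commShiftIso_hom_naturality]
      have h₂ : ((S.φ g).hom.app X.obj)⟦n⟧' ≫ ((S.φ g).inv.app X.obj)⟦n⟧' = 𝟙 _ := by
        rw [← Functor.map_comp, Iso.hom_inv_id_app, CategoryTheory.Functor.map_id]
      rw [← reassoc_of% h₁, reassoc_of% h₂]))
    (fun f => Equivariant.hom_ext ((Φ.commShiftIso n).hom.naturality f.hom))
  commShiftIso_zero := by
    ext X
    rw [Functor.CommShift.isoZero_hom_app]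
    have := NatTrans.congr_app (congrArg Iso.hom (Φ.commShiftIso_zero ℤ)) X.obj
    rw [Functor.CommShift.isoZero_hom_app] at this
    exact this
  commShiftIso_add n m := by
    ext X
    rw [Functor.CommShift.isoAdd_hom_app]
    have := NatTrans.congr_app (congrArg Iso.hom (Φ.commShiftIso_add n m)) X.obj
    rw [Functor.CommShift.isoAdd_hom_app] at this
    exact this

end EquivariantStructure

end EquivariantFunctor

section Triangulated

variable {G : Type w} [Group G] {𝒟 : Type u} [Category.{v} 𝒟] [Preadditive 𝒟] [HasShift 𝒟 ℤ]
  [HasZeroObject 𝒟] [∀ n : ℤ, (shiftFunctor 𝒟 n).Additive] [Pretriangulated 𝒟]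

/-- An action with commutation isomorphisms `θ_g` making the translation functor equivariant is
admissible if every `F_g`, equipped with `θ_g`, is exact. -/
class GroupAction.IsAdmissible (A : GroupAction G 𝒟) [A.ShiftStructure] : Prop where
  isTriangulated : ∀ g : G, (A.F g).IsTriangulated

instance (A : GroupAction G 𝒟) [A.ShiftStructure] [A.IsAdmissible] (g : G) :
    (A.F g).IsTriangulated := GroupAction.IsAdmissible.isTriangulated g

/-- A canonical triangulated structure on the category of equivariant objects: a triangulated
structure, with respect to the translation functor induced from `𝒟`, for which the forgetful
functor is exact. -/
class IsCanonicalTriangulated (A : GroupAction G 𝒟) [A.ShiftStructure]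
    (P : Pretriangulated (Equivariant A)) : Prop where
  isTriangulated : IsTriangulated (Equivariant A)
  isTriangulated_forget : (forget A).IsTriangulated

instance (A : GroupAction G 𝒟) [A.ShiftStructure] [P : Pretriangulated (Equivariant A)]
    [IsCanonicalTriangulated A P] : IsTriangulated (Equivariant A) :=
  IsCanonicalTriangulated.isTriangulated (A := A) (P := P)

instance (A : GroupAction G 𝒟) [A.ShiftStructure] [P : Pretriangulated (Equivariant A)]
    [IsCanonicalTriangulated A P] : (forget A).IsTriangulated :=
  IsCanonicalTriangulated.isTriangulated_forget (A := A) (P := P)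

/-- `C` is invariant under the action: `F_g(C) ⊆ C` for all `g`. -/
def GroupAction.Invariant (A : GroupAction G 𝒟) (C : ObjectProperty 𝒟) : Prop :=
  ∀ (g : G) (X : 𝒟), C X → C ((A.F g).obj X)

/-- The Verdier quotient: the localization at the morphisms whose cone lies in `C`. -/
abbrev VerdierQuotient (C : ObjectProperty 𝒟) : Type u := C.trW.Localization

/-- The quotient functor to the Verdier quotient. -/
abbrev verdierQ (C : ObjectProperty 𝒟) : 𝒟 ⥤ VerdierQuotient C := C.trW.Q

/-- An admissible action on the Verdier quotient `𝒟/C` induced by an action on `𝒟`: one for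
which the quotient functor is equivariant, compatibly with the commutation isomorphisms with
the shifts. -/
structure InducedAction [IsTriangulated 𝒟] (A : GroupAction G 𝒟) [A.ShiftStructure]
    (C : ObjectProperty 𝒟) [C.IsTriangulated] where
  /-- the action on `𝒟/C` -/
  action : GroupAction G (VerdierQuotient C)
  /-- its commutation isomorphisms with the shift -/
  shiftStructure : action.ShiftStructure
  isAdmissible : action.IsAdmissible
  /-- the equivariant structure of the quotient functor -/
  equivQ : EquivariantStructure A action (verdierQ C)
  commShift_equivQ : equivQ.CommShift

namespace InducedAction

variable [IsTriangulated 𝒟] {A : GroupAction G 𝒟} [A.ShiftStructure]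
    {C : ObjectProperty 𝒟} [C.IsTriangulated] (I : InducedAction A C)

instance : I.action.ShiftStructure := I.shiftStructure

instance : I.action.IsAdmissible := I.isAdmissible

instance : I.equivQ.CommShift := I.commShift_equivQ

end InducedAction

/-- The subcategory `C^G` of equivariant objects whose underlying object lies in `C`. -/
abbrev equivariantSubcategory (A : GroupAction G 𝒟) (C : ObjectProperty 𝒟) :
    ObjectProperty (Equivariant A) :=
  C.inverseImage (forget A)

section Comparison

variable [IsTriangulated 𝒟] {A : GroupAction G 𝒟} [A.ShiftStructure]
  [P : Pretriangulated (Equivariant A)] [IsCanonicalTriangulated A P]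
  {C : ObjectProperty 𝒟} [C.IsTriangulated] [C.IsClosedUnderIsomorphisms]

lemma InducedAction.inverts (I : InducedAction A C) :
    (equivariantSubcategory A C).trW.IsInvertedBy I.equivQ.map := by
  intro X Y f hf
  have h : IsIso ((forget A ⋙ verdierQ C).map f) :=
    C.inverseImage_trW_isInverted (forget A) (verdierQ C) f hf
  have : IsIso ((forget I.action).map (I.equivQ.map.map f)) := h
  exact isIso_of_reflects_iso _ (forget I.action)

/-- The natural functor `𝒟^G/C^G ⥤ (𝒟/C)^G`, induced by `Q^G : 𝒟^G ⥤ (𝒟/C)^G`. -/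
noncomputable def comparison (I : InducedAction A C) :
    VerdierQuotient (equivariantSubcategory A C) ⥤ Equivariant I.action :=
  Localization.lift I.equivQ.map I.inverts (verdierQ (equivariantSubcategory A C))

noncomputable instance (I : InducedAction A C) :
    Localization.Lifting (verdierQ (equivariantSubcategory A C))
      (equivariantSubcategory A C).trW I.equivQ.map (comparison I) :=
  inferInstanceAs (Localization.Lifting _ _ _ (Localization.lift _ _ _))

/-- The commutation of the natural functor with shifts, induced by that of `Q^G`. -/
noncomputable instance (I : InducedAction A C) : (comparison I).CommShift ℤ :=
  Functor.commShiftOfLocalization (verdierQ (equivariantSubcategory A C))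
    (equivariantSubcategory A C).trW ℤ I.equivQ.map (comparison I)

end Comparison

end Triangulated

/-- The integer `n` is invertible in the category: division of morphisms by `n` is uniquely
possible. -/
def IsInvertibleIn (n : ℤ) (𝒜 : Type u) [Category.{v} 𝒜] [Preadditive 𝒜] : Prop :=
  ∀ ⦃X Y : 𝒜⦄ (f : X ⟶ Y), ∃! g : X ⟶ Y, n • g = f

/-- An equivalence up to retracts: a fully faithful functor such that every object of the target
is a retract of an object in its essential image. -/
structure IsEquivalenceUpToRetracts {𝒜 : Type u} [Category.{v} 𝒜] {ℬ : Type u'}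
    [Category.{v'} ℬ] (Φ : 𝒜 ⥤ ℬ) : Prop where
  full : Φ.Full
  faithful : Φ.Faithful
  dense : ∀ Y : ℬ, ∃ Z : ℬ, Φ.essImage Z ∧ Nonempty (Retract Y Z)

end EquivTri

open EquivTri

/-! Everything rests on induction. For an object X the sum Ind X = ⨁ F_g X is equivariant, and for X
equivariant there are natural maps X ⟶ Ind ωX ⟶ X whose composite is |G| (`indUnit_indCounit`).
Since |G| is invertible, X is naturally a retract of Ind ωX, and averaging over G retracts Hom(X, Y)
⟶ Hom(ωX, ωY) compatibly with composition by equivariant morphisms (`averaging`).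

Roofs and vanishing relations in 𝒟/C involve morphisms s with cone in C that need not be
equivariant. But Ind s is equivariant, and its cone lies in C^G because C is invariant
(`trW_indMap`). Inducing the data and then applying the retraction proves that the comparison
functor is faithful and full. Because Ind commutes with Q, and Q is essentially surjective, every
object of (𝒟/C)^G is a retract of some Q^G(Ind X).

On (𝒟/C)^G, averaging fillers shows that a canonical structure must consist of the triangles that
become distinguished after forgetting (`Averaging.mem_distTriang_iff`). This gives uniqueness and
the exactness of the comparison functor. For existence, most axioms follow by averaging, and two
need work. Cones: each morphism is a retract of one in the image of the comparison functor, which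
has a cone. The idempotent cutting out the desired cone is not equivariant, but its average is
idempotent up to a square-zero error and can be corrected to a splitting idempotent
(`Averaging.exists_cone_of_retract`). Octahedra: after adding complements, the data lie in the image
of the full exact comparison functor, and the octahedron found there is cut down again
(`isTriangulated_of_dense`).

The action itself descends to 𝒟/C by the universal property of localization. -/

namespace EquivTri

/-! ### Retracts and direct sums of distinguished triangles. -/

section TriangleLemmas

variable {𝒯 : Type u} [Category.{v} 𝒯] [Preadditive 𝒯] [HasZeroObject 𝒯] [HasShift 𝒯 ℤ]
  [∀ n : ℤ, (shiftFunctor 𝒯 n).Additive] [Pretriangulated 𝒯]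

section

variable {X Y Z : 𝒯} {f : X ⟶ Y} {g : Y ⟶ Z} {h : Z ⟶ X⟦(1 : ℤ)⟧}
  {X' Y' Z' : 𝒯} {f' : X' ⟶ Y'} {g' : Y' ⟶ Z'} {h' : Z' ⟶ X'⟦(1 : ℤ)⟧}
  (hT : Triangle.mk f g h ∈ distTriang 𝒯)

include hT

lemma distTriang_zero₁₂ : f ≫ g = 0 := comp_distTriang_mor_zero₁₂ _ hT

lemma distTriang_zero₃₁ : h ≫ f⟦(1 : ℤ)⟧' = 0 := comp_distTriang_mor_zero₃₁ _ hT

lemma distTriang_exact₂ {W : 𝒯} (y : W ⟶ Y) (hy : y ≫ g = 0) : ∃ x : W ⟶ X, y = x ≫ f :=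
  Triangle.coyoneda_exact₂ _ hT y hy

lemma distTriang_exact₃ {W : 𝒯} (z : W ⟶ Z) (hz : z ≫ h = 0) : ∃ y : W ⟶ Y, z = y ≫ g :=
  Triangle.coyoneda_exact₃ _ hT z hz

lemma distTriang_exact₁ {W : 𝒯} (x : W ⟶ X⟦(1 : ℤ)⟧) (hx : x ≫ f⟦(1 : ℤ)⟧' = 0) :
    ∃ z : W ⟶ Z, x = z ≫ h :=
  Triangle.coyoneda_exact₁ _ hT x hx

lemma distTriang_coexact₃ {W : 𝒯} (z : Z ⟶ W) (hz : g ≫ z = 0) :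
    ∃ x : X⟦(1 : ℤ)⟧ ⟶ W, z = h ≫ x :=
  Triangle.yoneda_exact₃ _ hT z hz

lemma distTriang_complete (hT' : Triangle.mk f' g' h' ∈ distTriang 𝒯) (a : X ⟶ X') (b : Y ⟶ Y')
    (comm : f ≫ b = a ≫ f') :
    ∃ c : Z ⟶ Z', g ≫ c = b ≫ g' ∧ h ≫ a⟦(1 : ℤ)⟧' = c ≫ h' :=
  complete_distinguished_triangle_morphism _ _ hT hT' a b comm

/-- An endomorphism of a distinguished triangle that is the identity on the first two objects is
an isomorphism on the third. -/
lemma distTriang_isIso₃ (hT' : Triangle.mk f' g' h' ∈ distTriang 𝒯) (a : X ⟶ X') (b : Y ⟶ Y')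
    (c : Z ⟶ Z') (h₁ : f ≫ b = a ≫ f') (h₂ : g ≫ c = b ≫ g')
    (h₃ : h ≫ a⟦(1 : ℤ)⟧' = c ≫ h') [IsIso a] [IsIso b] : IsIso c :=
  isIso₃_of_isIso₁₂ (Triangle.homMk (Triangle.mk f g h) (Triangle.mk f' g' h') a b c h₁ h₂ h₃)
    hT hT' ‹_› ‹_›

/-- A triangle whose long sequence of represented functors is exact, and which receives a
morphism from a distinguished triangle that is the identity on the first two objects, is
distinguished. -/
lemma distinguished_of_exact {Z' : 𝒯} {g' : Y ⟶ Z'} {h' : Z' ⟶ X⟦(1 : ℤ)⟧} (c : Z ⟶ Z')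
    (hc₂ : g ≫ c = g') (hc₃ : c ≫ h' = h) (h₃₁ : h' ≫ f⟦(1 : ℤ)⟧' = 0)
    (ex₂ : ∀ {W : 𝒯} (y : W ⟶ Y), y ≫ g' = 0 → ∃ x, y = x ≫ f)
    (ex₃ : ∀ {W : 𝒯} (z : W ⟶ Z'), z ≫ h' = 0 → ∃ y, z = y ≫ g') :
    Triangle.mk f g' h' ∈ distTriang 𝒯 := by
  have hmono : Mono c := by
    rw [Preadditive.mono_iff_cancel_zero]
    intro W u hu
    obtain ⟨y, rfl⟩ := distTriang_exact₃ hT u (by rw [← hc₃, reassoc_of% hu, zero_comp])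
    obtain ⟨x, rfl⟩ := ex₂ y (by rwa [← hc₂, ← Category.assoc])
    rw [Category.assoc, distTriang_zero₁₂ hT, comp_zero]
  -- A lift `z` of `h'` through `h` is a section of `c` up to an error killed by `h'`; that error
  -- comes from `Y` and is subtracted.
  have hsplit : IsSplitEpi c := by
    obtain ⟨z, hz⟩ := distTriang_exact₁ hT h' h₃₁
    obtain ⟨y, hy⟩ := ex₃ (z ≫ c - 𝟙 _) (by
      rw [Preadditive.sub_comp, Category.assoc, hc₃, ← hz, Category.id_comp, sub_self])
    refine ⟨⟨z - y ≫ g, ?_⟩⟩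
    rw [Preadditive.sub_comp, Category.assoc, hc₂, ← hy]
    abel
  have : IsIso c := isIso_of_mono_of_isSplitEpi _
  refine isomorphic_distinguished _ hT _ (Triangle.isoMk (Triangle.mk f g' h') (Triangle.mk f g h)
    (Iso.refl X) (Iso.refl Y) (asIso c).symm ?_ ?_ ?_)
  · exact (Category.comp_id f).trans (Category.id_comp f).symm
  · change g' ≫ inv c = 𝟙 _ ≫ g
    rw [← hc₂, Category.assoc, IsIso.hom_inv_id, Category.comp_id, Category.id_comp]
  · change h' ≫ (𝟙 X)⟦(1 : ℤ)⟧' = inv c ≫ h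
    rw [← hc₃, CategoryTheory.Functor.map_id, Category.comp_id, IsIso.inv_hom_id_assoc]

end

/-- A retract of a distinguished triangle is distinguished. -/
lemma distinguished_of_retract {X Y Z : 𝒯} {f : X ⟶ Y} {g : Y ⟶ Z} {h : Z ⟶ X⟦(1 : ℤ)⟧}
    {X' Y' Z' : 𝒯} {f' : X' ⟶ Y'} {g' : Y' ⟶ Z'} {h' : Z' ⟶ X'⟦(1 : ℤ)⟧}
    (hT' : Triangle.mk f' g' h' ∈ distTriang 𝒯)
    {i₁ : X ⟶ X'} {i₂ : Y ⟶ Y'} {i₃ : Z ⟶ Z'} {r₁ : X' ⟶ X} {r₂ : Y' ⟶ Y} {r₃ : Z' ⟶ Z}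
    (ir₁ : i₁ ≫ r₁ = 𝟙 X) (ir₂ : i₂ ≫ r₂ = 𝟙 Y) (ir₃ : i₃ ≫ r₃ = 𝟙 Z)
    (hi₁ : f ≫ i₂ = i₁ ≫ f') (hi₂ : g ≫ i₃ = i₂ ≫ g') (hi₃ : h ≫ i₁⟦(1 : ℤ)⟧' = i₃ ≫ h')
    (hr₁ : f' ≫ r₂ = r₁ ≫ f) (hr₂ : g' ≫ r₃ = r₂ ≫ g) (hr₃ : h' ≫ r₁⟦(1 : ℤ)⟧' = r₃ ≫ h) :
    Triangle.mk f g h ∈ distTriang 𝒯 := by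
  obtain ⟨Z₀, g₀, h₀, hT₀⟩ := distinguished_cocone_triangle f
  -- The comparison from a genuine cone of `f` goes through the big triangle, as `c ≫ r₃`; the
  -- retract inherits the exactness of the big triangle.
  obtain ⟨c, hc₁, hc₂⟩ := distTriang_complete hT₀ hT' i₁ i₂ hi₁
  refine distinguished_of_exact hT₀ (c ≫ r₃) ?_ ?_ ?_ ?_ ?_
  · rw [reassoc_of% hc₁, hr₂, reassoc_of% ir₂]
  · rw [Category.assoc, ← hr₃, ← reassoc_of% hc₂, ← Functor.map_comp, ir₁,
      CategoryTheory.Functor.map_id, Category.comp_id]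
  · have e : h = i₃ ≫ h' ≫ r₁⟦(1 : ℤ)⟧' := by rw [hr₃, reassoc_of% ir₃]
    rw [e, Category.assoc, Category.assoc, ← Functor.map_comp, ← hr₁, Functor.map_comp,
      reassoc_of% (distTriang_zero₃₁ hT'), zero_comp, comp_zero]
  · intro W y hy
    obtain ⟨x, hx⟩ := distTriang_exact₂ hT' (y ≫ i₂) (by
      rw [Category.assoc, ← hi₂, reassoc_of% hy, zero_comp])
    exact ⟨x ≫ r₁, by rw [Category.assoc, ← hr₁, ← reassoc_of% hx, ir₂, Category.comp_id]⟩
  · intro W z hz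
    obtain ⟨y, hy⟩ := distTriang_exact₃ hT' (z ≫ i₃) (by
      rw [Category.assoc, ← hi₃, reassoc_of% hz, zero_comp])
    exact ⟨y ≫ r₂, by rw [Category.assoc, ← hr₂, ← reassoc_of% hy, ir₃, Category.comp_id]⟩

lemma shift_biprod_total (X X' : 𝒯) : (biprod.fst : X ⊞ X' ⟶ X)⟦(1 : ℤ)⟧' ≫ biprod.inl⟦(1 : ℤ)⟧' +
    (biprod.snd : X ⊞ X' ⟶ X')⟦(1 : ℤ)⟧' ≫ biprod.inr⟦(1 : ℤ)⟧' = 𝟙 _ := by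
  rw [← Functor.map_comp, ← Functor.map_comp, ← Functor.map_add, biprod.total,
    CategoryTheory.Functor.map_id]

/-- The direct sum of two distinguished triangles is distinguished. -/
lemma biprod_distinguished {X Y Z X' Y' Z' : 𝒯} {f : X ⟶ Y} {g : Y ⟶ Z} {h : Z ⟶ X⟦(1 : ℤ)⟧}
    {f' : X' ⟶ Y'} {g' : Y' ⟶ Z'} {h' : Z' ⟶ X'⟦(1 : ℤ)⟧}
    (hT : Triangle.mk f g h ∈ distTriang 𝒯) (hT' : Triangle.mk f' g' h' ∈ distTriang 𝒯) :
    Triangle.mk (biprod.map f f') (biprod.map g g')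
      (biprod.desc (h ≫ biprod.inl⟦(1 : ℤ)⟧') (h' ≫ biprod.inr⟦(1 : ℤ)⟧')) ∈ distTriang 𝒯 := by
  obtain ⟨W, u, t, hT₀⟩ := distinguished_cocone_triangle (biprod.map f f')
  -- A cone of the sum maps to each of the two cones; the pair of these maps is the comparison.
  obtain ⟨a, ha₁, ha₂⟩ := distTriang_complete hT₀ hT biprod.fst biprod.fst (biprod.map_fst _ _)
  obtain ⟨b, hb₁, hb₂⟩ := distTriang_complete hT₀ hT' biprod.snd biprod.snd (biprod.map_snd _ _)
  refine distinguished_of_exact hT₀ (biprod.lift a b) ?_ ?_ ?_ ?_ ?_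
  · apply biprod.hom_ext
    · simpa using ha₁
    · simpa using hb₁
  · rw [biprod.lift_desc, ← reassoc_of% ha₂, ← reassoc_of% hb₂, ← Preadditive.comp_add,
      shift_biprod_total, Category.comp_id]
  · ext
    · rw [biprod.inl_desc_assoc, Category.assoc, ← Functor.map_comp, biprod.inl_map,
        Functor.map_comp, reassoc_of% (distTriang_zero₃₁ hT), zero_comp, comp_zero]
    · rw [biprod.inr_desc_assoc, Category.assoc, ← Functor.map_comp, biprod.inr_map,
        Functor.map_comp, reassoc_of% (distTriang_zero₃₁ hT'), zero_comp, comp_zero]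
  · intro W y hy
    obtain ⟨x, hx⟩ := distTriang_exact₂ hT (y ≫ biprod.fst) (by
      rw [Category.assoc, ← biprod.map_fst, reassoc_of% hy, zero_comp])
    obtain ⟨x', hx'⟩ := distTriang_exact₂ hT' (y ≫ biprod.snd) (by
      rw [Category.assoc, ← biprod.map_snd, reassoc_of% hy, zero_comp])
    exact ⟨biprod.lift x x', by ext <;> simp [hx, hx']⟩
  · intro W z hz
    have hz' : (z ≫ biprod.fst) ≫ h ≫ biprod.inl⟦(1 : ℤ)⟧' +
        (z ≫ biprod.snd) ≫ h' ≫ biprod.inr⟦(1 : ℤ)⟧' = 0 := by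
      rw [← hz, biprod.desc_eq]; simp
    obtain ⟨x, hx⟩ := distTriang_exact₃ hT (z ≫ biprod.fst) (by
      have := hz' =≫ (biprod.fst : X ⊞ X' ⟶ X)⟦(1 : ℤ)⟧'
      simpa [← Functor.map_comp] using this)
    obtain ⟨x', hx'⟩ := distTriang_exact₃ hT' (z ≫ biprod.snd) (by
      have := hz' =≫ (biprod.snd : X ⊞ X' ⟶ X')⟦(1 : ℤ)⟧'
      simpa [← Functor.map_comp] using this)
    exact ⟨biprod.lift x x', by ext <;> simp [hx, hx']⟩

lemma distinguished_inl_snd (A B : 𝒯) :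
    Triangle.mk (biprod.inl : A ⟶ A ⊞ B) biprod.snd 0 ∈ distTriang 𝒯 :=
  binaryBiproductTriangle_distinguished A B

lemma distinguished_inl_inl (A U W : 𝒯) :
    Triangle.mk (biprod.inl ≫ biprod.inl : A ⟶ (A ⊞ U) ⊞ W) (biprod.map biprod.snd (𝟙 W)) 0 ∈
      distTriang 𝒯 :=
  isomorphic_distinguished _ (binaryBiproductTriangle_distinguished A (U ⊞ W)) _
    (Triangle.isoMk (Triangle.mk _ _ _) (Triangle.mk _ _ _)
      (Iso.refl A) (biprod.associator A U W) (Iso.refl (U ⊞ W))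
      (by
        change (biprod.inl ≫ biprod.inl) ≫ (biprod.associator A U W).hom = 𝟙 _ ≫ biprod.inl
        apply biprod.hom_ext
        · simp
        · apply biprod.hom_ext <;> simp)
      (by
        change biprod.map biprod.snd (𝟙 W) ≫ 𝟙 _ = (biprod.associator A U W).hom ≫ biprod.snd
        apply biprod.hom_ext <;> simp)
      (by
        exact zero_comp.trans comp_zero.symm))

end TriangleLemmas

/-! ### The octahedral axiom passes to the closure under retracts. -/

section Octahedra


variable {𝒯 : Type u} [Category.{v} 𝒯] [Preadditive 𝒯] [HasZeroObject 𝒯] [HasShift 𝒯 ℤ]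
  [∀ n : ℤ, (shiftFunctor 𝒯 n).Additive] [Pretriangulated 𝒯]

/-- An octahedron on `f ⊕ f'`, `g ⊕ g'`, where `f'` and `g'` are inclusions of direct summands,
can be cut down to an octahedron on `f`, `g`. -/
lemma octahedron_of_biprod {X Y Z Z₁₂ Z₂₃ Z₁₃ A U W : 𝒯} {f : X ⟶ Y} {g : Y ⟶ Z} {fg : X ⟶ Z}
    (comm : f ≫ g = fg)
    {v₁₂ : Y ⟶ Z₁₂} {w₁₂ : Z₁₂ ⟶ X⟦(1 : ℤ)⟧} (h₁₂ : Triangle.mk f v₁₂ w₁₂ ∈ distTriang 𝒯)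
    {v₂₃ : Z ⟶ Z₂₃} {w₂₃ : Z₂₃ ⟶ Y⟦(1 : ℤ)⟧} (h₂₃ : Triangle.mk g v₂₃ w₂₃ ∈ distTriang 𝒯)
    {v₁₃ : Z ⟶ Z₁₃} {w₁₃ : Z₁₃ ⟶ X⟦(1 : ℤ)⟧} (h₁₃ : Triangle.mk fg v₁₃ w₁₃ ∈ distTriang 𝒯)
    (comm' : biprod.map f (biprod.inl : A ⟶ A ⊞ U) ≫ biprod.map g (biprod.inl : _ ⟶ _ ⊞ W) =
      biprod.map fg (biprod.inl ≫ biprod.inl))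
    (O : Triangulated.Octahedron comm' (biprod_distinguished h₁₂ (distinguished_inl_snd A U))
      (biprod_distinguished h₂₃ (distinguished_inl_snd (A ⊞ U) W))
      (biprod_distinguished h₁₃ (distinguished_inl_inl A U W))) :
    Nonempty (Triangulated.Octahedron comm h₁₂ h₂₃ h₁₃) := by
  obtain ⟨m₁, m₃, c₁, c₂, c₃, c₄, mem⟩ := O
  -- The cones of the added inclusions are U, U ⊞ W and W. On these summands `m₁` and `m₃` are
  -- forced to be the obvious maps; only cross terms from `Z₁₂` and `Z₁₃` into U and W remain.
  have inr_m₁ : biprod.inr ≫ m₁ = biprod.inl ≫ biprod.inr := by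
    have := (biprod.inr ≫ biprod.inr) ≫= c₁
    simpa using this
  have inr_m₃ : biprod.inr ≫ m₃ = biprod.snd ≫ biprod.inr := by
    have e := biprod.inr ≫= c₃
    apply biprod.hom_ext'
    · have := biprod.inr ≫= biprod.inl ≫= e
      simpa using this
    · have := biprod.inr ≫= e
      simpa using this
  have dz : ∀ {P Q R S : 𝒯} (a : P ⟶ R) (k : S ⟶ R),
      biprod.desc a ((0 : Q ⟶ S) ≫ k) = biprod.fst ≫ a := by
    intro P Q R S a k
    ext <;> simp
  rw [dz, dz] at c₂ c₄
  have hd : (biprod.fst ≫ w₂₃ ≫ (biprod.inl : Y ⟶ Y ⊞ (A ⊞ U))⟦(1 : ℤ)⟧') ≫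
      (biprod.map v₁₂ biprod.snd)⟦(1 : ℤ)⟧' =
      (biprod.fst : Z₂₃ ⊞ W ⟶ Z₂₃) ≫ w₂₃ ≫ v₁₂⟦(1 : ℤ)⟧' ≫ biprod.inl⟦(1 : ℤ)⟧' := by
    rw [Category.assoc, Category.assoc, ← Functor.map_comp, biprod.inl_map, Functor.map_comp]
  rw [dz, hd] at mem
  have z₁₂ := distTriang_zero₁₂ mem
  have z₃₁ := distTriang_zero₃₁ mem
  have hb : w₂₃ ≫ v₁₂⟦(1 : ℤ)⟧' ≫ (biprod.inl ≫ m₁ ≫ biprod.snd ≫ biprod.fst)⟦(1 : ℤ)⟧' = 0 := by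
    have := biprod.inl ≫= z₃₁ =≫ (biprod.snd ≫ biprod.fst)⟦(1 : ℤ)⟧'
    simpa using this
  -- Composing `m₁` with `m₃` gives zero; its component from `Z₁₂` to W expresses one cross term by
  -- the other.
  have hc : biprod.inl ≫ m₁ ≫ biprod.snd ≫ biprod.snd =
      -((biprod.inl ≫ m₁ ≫ biprod.fst) ≫ biprod.inl ≫ m₃ ≫ biprod.snd) := by
    have e : biprod.inl ≫ (m₁ ≫ (biprod.fst ≫ biprod.inl + biprod.snd ≫ biprod.inr)) ≫ m₃ ≫
        biprod.snd = 0 := by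
      rw [biprod.total, Category.comp_id, reassoc_of% z₁₂, zero_comp, comp_zero]
    simp only [Preadditive.comp_add, Preadditive.add_comp, Category.assoc, reassoc_of% inr_m₃,
      biprod.inr_snd, Category.comp_id] at e
    rw [eq_neg_iff_add_eq_zero, add_comm]
    simpa using e
  refine ⟨⟨biprod.inl ≫ m₁ ≫ biprod.fst, biprod.inl ≫ m₃ ≫ biprod.fst, ?_, ?_, ?_, ?_, ?_⟩⟩
  · have := biprod.inl ≫= c₁ =≫ biprod.fst
    simpa using this
  · have := biprod.inl ≫= c₂ =≫ (biprod.fst)⟦(1 : ℤ)⟧'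
    simpa [← Functor.map_comp] using this
  · have := biprod.inl ≫= c₃ =≫ biprod.fst
    simpa using this
  · have := biprod.inl ≫= c₄ =≫ (biprod.fst)⟦(1 : ℤ)⟧'
    simpa [← Functor.map_comp] using this
  -- The signs in the inclusions `i₁` and `i₂` shear away the cross terms, so that the small
  -- triangle is a retract of the given one.
  · refine distinguished_of_retract mem
      (i₁ := biprod.lift (𝟙 _) (-(biprod.inl ≫ m₁ ≫ biprod.snd ≫ biprod.fst)))
      (i₂ := biprod.lift (𝟙 _) (biprod.lift 0 (-(biprod.inl ≫ m₃ ≫ biprod.snd))))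
      (i₃ := biprod.inl) (r₁ := biprod.fst) (r₂ := biprod.fst) (r₃ := biprod.fst)
      (by simp) (by simp) (by simp) ?_ ?_ ?_ ?_ ?_ ?_
    · rw [show biprod.lift (𝟙 Z₁₂) _ = _ from biprod.lift_eq]
      apply biprod.hom_ext
      · simp [inr_m₁]
      · apply biprod.hom_ext
        · simp [inr_m₁]
        · simp only [Category.assoc] at hc
          simp [inr_m₁, hc]
    · rw [show biprod.lift (𝟙 Z₁₃) _ = _ from biprod.lift_eq]
      apply biprod.hom_ext <;> simp [inr_m₃]
    · rw [biprod.lift_eq, Functor.map_add]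
      simp only [Functor.map_comp] at hb
      simp [reassoc_of% hb]
    · apply biprod.hom_ext'
      · simp
      · simp [reassoc_of% inr_m₁]
    · apply biprod.hom_ext'
      · simp
      · simp [reassoc_of% inr_m₃]
    · simp [← Functor.map_comp]

/-- In a pretriangulated category, retracts have complements. -/
lemma exists_biprod_iso_of_retract {X Y : 𝒯} (r : Retract X Y) :
    ∃ X' : 𝒯, Nonempty (Y ≅ X ⊞ X') := by
  obtain ⟨X', g, h, hT⟩ := distinguished_cocone_triangle r.i
  -- The connecting morphism dies after composition with the shift of `r.i`, which is a split
  -- monomorphism.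
  have hh : h = 0 := by
    have e := distTriang_zero₃₁ hT =≫ r.r⟦(1 : ℤ)⟧'
    rwa [Category.assoc, ← Functor.map_comp, r.retract, CategoryTheory.Functor.map_id,
      Category.comp_id, zero_comp] at e
  obtain ⟨e, -⟩ := exists_iso_binaryBiproduct_of_distTriang _ hT hh
  exact ⟨X', ⟨e⟩⟩

/-- A rearrangement of summands. -/
noncomputable def biprodExchange (X A Y B : 𝒯) : (X ⊞ A) ⊞ (Y ⊞ B) ≅ Y ⊞ (A ⊞ (X ⊞ B)) where
  hom := biprod.lift (biprod.snd ≫ biprod.fst) (biprod.lift (biprod.fst ≫ biprod.snd)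
    (biprod.lift (biprod.fst ≫ biprod.fst) (biprod.snd ≫ biprod.snd)))
  inv := biprod.lift (biprod.lift (biprod.snd ≫ biprod.snd ≫ biprod.fst)
    (biprod.snd ≫ biprod.fst)) (biprod.lift biprod.fst (biprod.snd ≫ biprod.snd ≫ biprod.snd))
  hom_inv_id := by
    apply biprod.hom_ext <;> apply biprod.hom_ext <;> simp
  inv_hom_id := by
    apply biprod.hom_ext
    · simp
    · apply biprod.hom_ext
      · simp
      · apply biprod.hom_ext <;> simp

variable {𝒮 : Type u'} [Category.{v'} 𝒮] [Preadditive 𝒮] [HasZeroObject 𝒮] [HasShift 𝒮 ℤ]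
  [∀ n : ℤ, (shiftFunctor 𝒮 n).Additive] [Pretriangulated 𝒮] [IsTriangulated 𝒮]
  (K : 𝒮 ⥤ 𝒯) [K.CommShift ℤ] [K.IsTriangulated] [K.Full]

/-- Fullness lifts both morphisms to 𝒮. The octahedron found there is mapped by `K` and transported
to the prescribed cones. -/
lemma octahedron_of_essImage {X Y Z Z₁₂ Z₂₃ Z₁₃ : 𝒯}
    (hX : K.essImage X) (hY : K.essImage Y) (hZ : K.essImage Z)
    {f : X ⟶ Y} {g : Y ⟶ Z} {fg : X ⟶ Z} (comm : f ≫ g = fg)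
    {v₁₂ : Y ⟶ Z₁₂} {w₁₂ : Z₁₂ ⟶ X⟦(1 : ℤ)⟧} (h₁₂ : Triangle.mk f v₁₂ w₁₂ ∈ distTriang 𝒯)
    {v₂₃ : Z ⟶ Z₂₃} {w₂₃ : Z₂₃ ⟶ Y⟦(1 : ℤ)⟧} (h₂₃ : Triangle.mk g v₂₃ w₂₃ ∈ distTriang 𝒯)
    {v₁₃ : Z ⟶ Z₁₃} {w₁₃ : Z₁₃ ⟶ X⟦(1 : ℤ)⟧} (h₁₃ : Triangle.mk fg v₁₃ w₁₃ ∈ distTriang 𝒯) :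
    Nonempty (Triangulated.Octahedron comm h₁₂ h₂₃ h₁₃) := by
  obtain ⟨x, ⟨eX⟩⟩ := hX
  obtain ⟨y, ⟨eY⟩⟩ := hY
  obtain ⟨z, ⟨eZ⟩⟩ := hZ
  obtain ⟨f', hf'⟩ := K.map_surjective (eX.hom ≫ f ≫ eY.inv)
  obtain ⟨g', hg'⟩ := K.map_surjective (eY.hom ≫ g ≫ eZ.inv)
  obtain ⟨_, _, _, h₁₂'⟩ := distinguished_cocone_triangle f'
  obtain ⟨_, _, _, h₂₃'⟩ := distinguished_cocone_triangle g'
  obtain ⟨_, _, _, h₁₃'⟩ := distinguished_cocone_triangle (f' ≫ g')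
  exact ⟨Triangulated.Octahedron.ofIso (e₁ := eX.symm) (e₂ := eY.symm) (e₃ := eZ.symm)
    (comm₁₂ := by
      change f ≫ eY.inv = eX.inv ≫ K.map f'
      rw [hf', Iso.inv_hom_id_assoc])
    (comm₂₃ := by
      change g ≫ eZ.inv = eY.inv ≫ K.map g'
      rw [hg', Iso.inv_hom_id_assoc])
    (H := (Triangulated.someOctahedron rfl h₁₂' h₂₃' h₁₃').map K) ..⟩

/-- A pretriangulated category is triangulated if it is the closure under retracts of a full
triangulated subcategory. -/
lemma isTriangulated_of_dense (hK : ∀ Y : 𝒯, ∃ Z : 𝒯, K.essImage Z ∧ Nonempty (Retract Y Z)) :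
    IsTriangulated 𝒯 where
  octahedron_axiom {X Y Z Z₁₂ Z₂₃ Z₁₃ f g fg} comm _ _ h₁₂ _ _ h₂₃ _ _ h₁₃ := by
    have compl : ∀ X : 𝒯, ∃ X' : 𝒯, K.essImage (X ⊞ X') := fun X => by
      obtain ⟨Y, hY, ⟨r⟩⟩ := hK X
      obtain ⟨X', ⟨e⟩⟩ := exists_biprod_iso_of_retract r
      exact ⟨X', K.essImage.prop_of_iso e hY⟩
    have sum : ∀ {P Q : 𝒯}, K.essImage P → K.essImage Q → K.essImage (P ⊞ Q) := fun hP hQ =>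
      K.essImage.ext_of_isTriangulatedClosed₂ _ (binaryBiproductTriangle_distinguished _ _) hP hQ
    obtain ⟨A, hA⟩ := compl X
    obtain ⟨Y', hY'⟩ := compl Y
    obtain ⟨Z', hZ'⟩ := compl Z
    -- The complement of Y must contain A as a summand, to receive the split inclusion of A. Adding
    -- X ⊞ Y' as well regroups the total into (X ⊞ A) ⊞ (Y ⊞ Y'). The complement of Z is found in
    -- the same way.
    have hB := K.essImage.prop_of_iso (biprodExchange X A Y Y') (sum hA hY')
    have hC := K.essImage.prop_of_iso (biprodExchange Y _ Z Z') (sum hB hZ')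
    have comm' : biprod.map f (biprod.inl : A ⟶ A ⊞ (X ⊞ Y')) ≫
        biprod.map g (biprod.inl : _ ⟶ _ ⊞ (Y ⊞ Z')) =
        biprod.map fg (biprod.inl ≫ biprod.inl) := by
      rw [← comm]
      apply biprod.hom_ext' <;> simp
    obtain ⟨O⟩ := octahedron_of_essImage K hA hB hC comm'
      (biprod_distinguished h₁₂ (distinguished_inl_snd _ _))
      (biprod_distinguished h₂₃ (distinguished_inl_snd _ _))
      (biprod_distinguished h₁₃ (distinguished_inl_inl _ _ _))
    exact octahedron_of_biprod comm h₁₂ h₂₃ h₁₃ comm' O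

end Octahedra

/-! ### Idempotents modulo square-zero errors. -/

section Idempotents

/-- Multiply (a - b)² = 0 by a on the left: the two terms ab cancel and a - aba is left. -/
lemma mul_mul_self_of_sub_sq_eq_zero {R : Type*} [Ring R] {a b : R} (ha : a * a = a)
    (hb : b * b = b) (h : (a - b) * (a - b) = 0) : a * b * a = a := by
  have e : a * ((a - b) * (a - b)) = a * a * a - a * a * b - a * b * a + a * (b * b) := by
    noncomm_ring
  rw [h, mul_zero, ha, ha, hb] at e
  rw [← sub_eq_zero, ← neg_eq_zero, e]
  abel

/-- For p = 3t² - 2t³ one has p² - p = (t² - t)²(4t² - 4t - 3). -/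
lemma isIdempotentElem_of_sq_sub_sq_eq_zero {R : Type*} [Ring R] {a : R}
    (h : (a * a - a) * (a * a - a) = 0) :
    (3 • (a * a) - 2 • (a * a * a)) * (3 • (a * a) - 2 • (a * a * a)) =
      3 • (a * a) - 2 • (a * a * a) := by
  have e : (3 • (a * a) - 2 • (a * a * a)) * (3 • (a * a) - 2 • (a * a * a)) -
      (3 • (a * a) - 2 • (a * a * a)) =
      (a * a - a) * (a * a - a) * (4 • (a * a) - 4 • a - 3) := by
    noncomm_ring
  rw [← sub_eq_zero, e, h, zero_mul]

variable {𝒜 : Type u} [Category.{v} 𝒜] [Preadditive 𝒜]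

/-- An idempotent that differs from a split idempotent by a morphism of square zero splits. -/
lemma exists_splitting_of_sub_sq_eq_zero {Z Z' : 𝒜} {α : Z ⟶ Z'} {β : Z' ⟶ Z} {e : Z' ⟶ Z'}
    (hαβ : α ≫ β = 𝟙 Z) (he : e ≫ e = e) (h : (e - β ≫ α) ≫ (e - β ≫ α) = 0) :
    ∃ (i : Z ⟶ Z') (p : Z' ⟶ Z), i ≫ p = 𝟙 Z ∧ p ≫ i = e := by
  have hε : (β ≫ α) ≫ β ≫ α = β ≫ α := by rw [Category.assoc, reassoc_of% hαβ]
  have h₁ : e ≫ (β ≫ α) ≫ e = e :=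
    mul_mul_self_of_sub_sq_eq_zero (R := End Z') (a := e) (b := β ≫ α) he hε h
  have h₂ : (β ≫ α) ≫ e ≫ β ≫ α = β ≫ α :=
    mul_mul_self_of_sub_sq_eq_zero (R := End Z') (a := β ≫ α) (b := e) hε he (by
      rw [← neg_sub, neg_mul_neg]; exact h)
  -- With ε = `β ≫ α`, the relations eεe = e and εeε = ε make e and ε equivalent idempotents, so e
  -- splits through the same object `Z`.
  refine ⟨α ≫ e, e ≫ β, ?_, ?_⟩
  · have := α ≫= h₂ =≫ β
    simp only [Category.assoc, reassoc_of% hαβ, hαβ] at this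
    simpa [reassoc_of% he] using this
  · simpa using h₁

/-- If `a² - a` has square zero, then `3a² - 2a³` is idempotent. -/
lemma exists_idempotent_of_sq_eq_zero {Z : 𝒜} {a : Z ⟶ Z}
    (h : (a ≫ a - a) ≫ (a ≫ a - a) = 0) :
    (3 • (a ≫ a) - 2 • (a ≫ a ≫ a)) ≫ (3 • (a ≫ a) - 2 • (a ≫ a ≫ a)) =
      3 • (a ≫ a) - 2 • (a ≫ a ≫ a) :=
  isIdempotentElem_of_sq_sub_sq_eq_zero (R := End Z) (a := a) h

end Idempotents

/-! ### Triangulated structures created by a functor with an averaging operator. -/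

section Averaging

variable {ℰ : Type u} [Category.{v} ℰ] {ℬ : Type u'} [Category.{v'} ℬ]

/-- A natural retraction of the maps `Hom(X, Y) → Hom(ωX, ωY)`. -/
structure Averaging (ω : ℰ ⥤ ℬ) where
  /-- the retraction -/
  av : ∀ {X Y : ℰ}, (ω.obj X ⟶ ω.obj Y) → (X ⟶ Y)
  av_map : ∀ {X Y : ℰ} (f : X ⟶ Y), av (ω.map f) = f
  av_map_comp : ∀ {X Y Z : ℰ} (f : X ⟶ Y) (g : ω.obj Y ⟶ ω.obj Z), av (ω.map f ≫ g) = f ≫ av g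
  av_comp_map : ∀ {X Y Z : ℰ} (f : ω.obj X ⟶ ω.obj Y) (g : Y ⟶ Z), av (f ≫ ω.map g) = av f ≫ g

namespace Averaging

variable {ω : ℰ ⥤ ℬ} (R : Averaging ω)

include R in
lemma map_injective {X Y : ℰ} {f g : X ⟶ Y} (h : ω.map f = ω.map g) : f = g := by
  rw [← R.av_map f, h, R.av_map]

variable [Preadditive ℰ] [HasShift ℰ ℤ]
  [Preadditive ℬ] [HasZeroObject ℬ] [HasShift ℬ ℤ]
  [∀ n : ℤ, (shiftFunctor ℬ n).Additive] [Pretriangulated ℬ] [ω.CommShift ℤ] [ω.Additive]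

include R in
/-- A morphism `f` has a cone for the triangles created by `ω` if it is a retract of a morphism
that has one, provided that idempotents of `ℰ` split as soon as they split in `ℬ`. -/
lemma exists_cone_of_retract
    (hω : ∀ {X : ℰ} {Z : ℬ} (e : X ⟶ X) (i : Z ⟶ ω.obj X) (p : ω.obj X ⟶ Z), i ≫ p = 𝟙 Z →
      p ≫ i = ω.map e → ∃ (Z' : ℰ) (i' : Z' ⟶ X) (p' : X ⟶ Z'), i' ≫ p' = 𝟙 Z' ∧ p' ≫ i' = e)
    {X Y X' Y' Z' : ℰ} {f : X ⟶ Y} {f' : X' ⟶ Y'} {g' : Y' ⟶ Z'} {h' : Z' ⟶ X'⟦(1 : ℤ)⟧}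
    (rX : Retract X X') (rY : Retract Y Y') (hi : f ≫ rY.i = rX.i ≫ f')
    (hr : f' ≫ rY.r = rX.r ≫ f)
    (hT' : ω.mapTriangle.obj (Triangle.mk f' g' h') ∈ distTriang ℬ) :
    ∃ (Z : ℰ) (g : Y ⟶ Z) (h : Z ⟶ X⟦(1 : ℤ)⟧),
      ω.mapTriangle.obj (Triangle.mk f g h) ∈ distTriang ℬ := by
  replace hT' : Triangle.mk (ω.map f') (ω.map g')
    (ω.map h' ≫ (ω.commShiftIso (1 : ℤ)).hom.app X') ∈ distTriang ℬ := hT'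
  obtain ⟨Z₀, g₀, h₀, hT₀⟩ := distinguished_cocone_triangle (ω.map f)
  obtain ⟨α, hα₂, hα₃⟩ := distTriang_complete hT₀ hT' (ω.map rX.i) (ω.map rY.i) (by
    rw [← ω.map_comp, hi, ω.map_comp])
  obtain ⟨β, hβ₂, hβ₃⟩ := distTriang_complete hT' hT₀ (ω.map rX.r) (ω.map rY.r) (by
    rw [← ω.map_comp, hr, ω.map_comp])
  have irX : ω.map rX.i ≫ ω.map rX.r = 𝟙 _ := by
    rw [← ω.map_comp, rX.retract, CategoryTheory.Functor.map_id]
  have irY : ω.map rY.i ≫ ω.map rY.r = 𝟙 _ := by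
    rw [← ω.map_comp, rY.retract, CategoryTheory.Functor.map_id]
  have hg₀ : g₀ ≫ α ≫ β = g₀ := by
    rw [reassoc_of% hα₂, hβ₂, reassoc_of% irY]
  have hh₀ : (α ≫ β) ≫ h₀ = h₀ := by
    rw [Category.assoc, ← hβ₃, Category.assoc, ← reassoc_of% hα₃, ← Functor.map_comp, irX,
      CategoryTheory.Functor.map_id, Category.comp_id]
  have : IsIso (α ≫ β) := distTriang_isIso₃ hT₀ hT₀ (𝟙 _) (𝟙 _) _ (by simp) (by simpa using hg₀)
    (by simpa using hh₀.symm)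
  -- The composite `α ≫ β` is invertible but need not be the identity. Correcting `β` by its inverse
  -- makes `Z₀` a retract of `ω.obj Z'`.
  obtain ⟨β', hαβ, hβ₂', hβ₃'⟩ : ∃ β' : ω.obj Z' ⟶ Z₀, α ≫ β' = 𝟙 _ ∧
      ω.map g' ≫ β' = ω.map rY.r ≫ g₀ ∧
      (ω.map h' ≫ (ω.commShiftIso (1 : ℤ)).hom.app X') ≫ (ω.map rX.r)⟦(1 : ℤ)⟧' = β' ≫ h₀ := by
    refine ⟨β ≫ inv (α ≫ β), ?_, ?_, ?_⟩
    · rw [← Category.assoc, IsIso.hom_inv_id]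
    · rw [reassoc_of% hβ₂, IsIso.comp_inv_eq (α ≫ β) |>.2 hg₀.symm]
    · rw [hβ₃, Category.assoc, IsIso.inv_comp_eq (α ≫ β) |>.2 hh₀.symm]
  have hε₂ : ω.map g' ≫ β' ≫ α = ω.map (rY.r ≫ rY.i ≫ g') := by
    rw [reassoc_of% hβ₂', hα₂, ω.map_comp, ω.map_comp]
  have hε₃ : (β' ≫ α) ≫ ω.map h' = ω.map (h' ≫ rX.r⟦(1 : ℤ)⟧' ≫ rX.i⟦(1 : ℤ)⟧') := by
    rw [← cancel_mono ((ω.commShiftIso (1 : ℤ)).hom.app X'), Category.assoc, Category.assoc,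
      ← hα₃, ← reassoc_of% hβ₃']
    simp
  have ha₂ : g' ≫ R.av (β' ≫ α) = rY.r ≫ rY.i ≫ g' := by
    rw [← R.av_map_comp, hε₂, R.av_map]
  have ha₃ : R.av (β' ≫ α) ≫ h' = h' ≫ rX.r⟦(1 : ℤ)⟧' ≫ rX.i⟦(1 : ℤ)⟧' := by
    rw [← R.av_comp_map, hε₃, R.av_map]
  -- The idempotent `β' ≫ α` need not come from ℰ, but its composites with `g'` and `h'` do. Hence
  -- its average `a` has the same composites with them.
  generalize R.av (β' ≫ α) = a at ha₂ ha₃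
  have irX' : rX.i⟦(1 : ℤ)⟧' ≫ rX.r⟦(1 : ℤ)⟧' = 𝟙 _ := by
    rw [← Functor.map_comp, rX.retract, CategoryTheory.Functor.map_id]
  have haa₂ : g' ≫ a ≫ a = g' ≫ a := by
    rw [reassoc_of% ha₂, ha₂, rY.retract_assoc]
  have haa₃ : (a ≫ a) ≫ h' = a ≫ h' := by
    rw [Category.assoc, ha₃, reassoc_of% ha₃, reassoc_of% irX']
  -- Such an `n` factors through the connecting morphism, which kills the first factor of `n ≫ n`.
  have sq : ∀ n : ω.obj Z' ⟶ ω.obj Z', ω.map g' ≫ n = 0 → n ≫ ω.map h' = 0 → n ≫ n = 0 := by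
    intro n hn₂ hn₃
    obtain ⟨x, hx⟩ := distTriang_coexact₃ hT' n hn₂
    nth_rw 2 [hx]
    rw [Category.assoc, reassoc_of% hn₃, zero_comp]
  have haa : (a ≫ a - a) ≫ (a ≫ a - a) = 0 := R.map_injective (by
    rw [ω.map_comp, ω.map_zero]
    refine sq _ ?_ ?_
    · rw [← ω.map_comp, Preadditive.comp_sub, haa₂, sub_self, ω.map_zero]
    · rw [← ω.map_comp, Preadditive.sub_comp, haa₃, sub_self, ω.map_zero])
  have he := exists_idempotent_of_sq_eq_zero haa
  -- After `g'`, or before `h'`, all powers of `a` agree, and the coefficients 3 and -2 add up to 1.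
  have he₂ : g' ≫ (3 • (a ≫ a) - 2 • (a ≫ a ≫ a)) = g' ≫ a := by
    have : g' ≫ a ≫ a ≫ a = g' ≫ a := by rw [reassoc_of% haa₂, haa₂]
    rw [Preadditive.comp_sub, Preadditive.comp_nsmul, Preadditive.comp_nsmul, haa₂, this]
    abel
  have he₃ : (3 • (a ≫ a) - 2 • (a ≫ a ≫ a)) ≫ h' = a ≫ h' := by
    have : (a ≫ a ≫ a) ≫ h' = a ≫ h' := by rw [Category.assoc, haa₃, ← Category.assoc, haa₃]
    rw [Preadditive.sub_comp, Preadditive.nsmul_comp, Preadditive.nsmul_comp, haa₃, this]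
    abel
  generalize 3 • (a ≫ a) - 2 • (a ≫ a ≫ a) = e at he he₂ he₃
  rw [ha₂] at he₂
  rw [ha₃] at he₃
  -- The idempotent `e` and the split idempotent `β' ≫ α` have the same composites with `g'` and
  -- `h'`, so their difference has square zero.
  obtain ⟨i₀, p₀, hip₀, hpi₀⟩ := exists_splitting_of_sub_sq_eq_zero (e := ω.map e) hαβ
    (by rw [← ω.map_comp, he]) (sq _ (by
      rw [Preadditive.comp_sub, hε₂, ← ω.map_comp, he₂, sub_self]) (by
      rw [Preadditive.sub_comp, hε₃, ← ω.map_comp, he₃, sub_self]))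
  obtain ⟨Z, i, p, hip, hpi⟩ := hω e i₀ p₀ hip₀ hpi₀
  refine ⟨Z, rY.i ≫ g' ≫ p, i ≫ h' ≫ rX.r⟦(1 : ℤ)⟧', ?_⟩
  refine distinguished_of_retract (f := ω.map f) (g := ω.map (rY.i ≫ g' ≫ p))
    (h := ω.map (i ≫ h' ≫ rX.r⟦(1 : ℤ)⟧') ≫ (ω.commShiftIso (1 : ℤ)).hom.app X) hT'
    irX irY (i₃ := ω.map i) (r₃ := ω.map p) ?_ ?_ ?_ ?_ ?_ ?_ ?_
  · rw [← ω.map_comp, hip, CategoryTheory.Functor.map_id]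
  · rw [← ω.map_comp, hi, ω.map_comp]
  · rw [← ω.map_comp, ← ω.map_comp, Category.assoc, Category.assoc, hpi, he₂, rY.retract_assoc]
  · rw [Category.assoc, ← ω.commShiftIso_hom_naturality, ← ω.map_comp_assoc, Category.assoc,
      Category.assoc, ← he₃, ← hpi, Category.assoc, reassoc_of% hip, ω.map_comp, Category.assoc]
  · rw [← ω.map_comp, hr, ω.map_comp]
  · rw [← ω.map_comp, ← ω.map_comp, ← reassoc_of% he₂, ← hpi, Category.assoc, hip,
      Category.comp_id]
  · rw [Category.assoc, ← ω.commShiftIso_hom_naturality, ← ω.map_comp_assoc, ← ω.map_comp_assoc,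
      reassoc_of% hpi, reassoc_of% he₃, irX', Category.comp_id]

variable [HasZeroObject ℰ] [∀ n : ℤ, (shiftFunctor ℰ n).Additive]

/-- The pretriangulated structure created by `ω`, if cones exist. -/
@[reducible]
def pretriangulated (hcone : ∀ {X Y : ℰ} (f : X ⟶ Y), ∃ (Z : ℰ) (g : Y ⟶ Z) (h : Z ⟶ X⟦(1 : ℤ)⟧),
    ω.mapTriangle.obj (Triangle.mk f g h) ∈ distTriang ℬ) : Pretriangulated ℰ where
  distinguishedTriangles := {T | ω.mapTriangle.obj T ∈ distTriang ℬ}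
  isomorphic_distinguished T₁ hT₁ T₂ e :=
    isomorphic_distinguished _ hT₁ _ (ω.mapTriangle.mapIso e)
  contractible_distinguished X := by
    refine isomorphic_distinguished _ (contractible_distinguished (ω.obj X)) _
      (Triangle.isoMk (Triangle.mk _ _ _) (Triangle.mk _ _ _) (Iso.refl _) (Iso.refl _)
        ω.mapZeroObject ?_ ?_ ?_)
    · change ω.map (𝟙 X) ≫ 𝟙 _ = 𝟙 _ ≫ 𝟙 _
      simp
    · exact (isZero_zero ℬ).eq_of_tgt _ _
    · exact (ω.map_isZero (isZero_zero ℰ)).eq_of_src _ _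
  distinguished_cocone_triangle f := hcone f
  rotate_distinguished_triangle T :=
    (rotate_distinguished_triangle (ω.mapTriangle.obj T)).trans
      (distinguished_iff_of_iso (ω.mapTriangleRotateIso.app T))
  complete_distinguished_triangle_morphism T₁ T₂ hT₁ hT₂ a b comm := by
    obtain ⟨c, hc₂, hc₃⟩ := distTriang_complete (f := ω.map T₁.mor₁) (f' := ω.map T₂.mor₁) hT₁ hT₂
      (ω.map a) (ω.map b) (by rw [← ω.map_comp, comm, ω.map_comp])
    -- Averaging commutes with composition by morphisms of ℰ, so the average of a filler found in ℬ
    -- still fills both squares.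
    refine ⟨R.av c, ?_, ?_⟩
    · rw [← R.av_map_comp, hc₂, ← ω.map_comp, R.av_map]
    · rw [← R.av_comp_map, ← R.av_map (T₁.mor₃ ≫ _)]
      congr 1
      rw [← cancel_mono ((ω.commShiftIso (1 : ℤ)).hom.app T₂.obj₁), Category.assoc, ← hc₃]
      simp

omit [ω.Additive] in
include R in
/-- Any pretriangulated structure for which `ω` is exact has as distinguished triangles those
created by `ω`. -/
lemma mem_distTriang_iff [ω.ReflectsIsomorphisms] [Pretriangulated ℰ] [ω.IsTriangulated]
    (T : Triangle ℰ) : T ∈ distTriang ℰ ↔ ω.mapTriangle.obj T ∈ distTriang ℬ := by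
  refine ⟨ω.map_distinguished T, fun hT => ?_⟩
  obtain ⟨Z, g, h, hT₀⟩ := distinguished_cocone_triangle T.mor₁
  have hT' : Triangle.mk (ω.map T.mor₁) (ω.map T.mor₂)
    (ω.map T.mor₃ ≫ (ω.commShiftIso (1 : ℤ)).hom.app T.obj₁) ∈ distTriang ℬ := hT
  have hT₀' : Triangle.mk (ω.map T.mor₁) (ω.map g)
    (ω.map h ≫ (ω.commShiftIso (1 : ℤ)).hom.app T.obj₁) ∈ distTriang ℬ :=
      ω.map_distinguished _ hT₀
  -- The averaged filler compares `T` with a distinguished triangle on the same first morphism; it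
  -- becomes invertible in ℬ by the five lemma, hence it is invertible in ℰ.
  obtain ⟨c, hc₂, hc₃⟩ := distTriang_complete hT₀' hT' (𝟙 _) (𝟙 _) (by simp)
  have h₂ : g ≫ R.av c = T.mor₂ := by
    rw [← R.av_map_comp, hc₂, Category.id_comp, R.av_map]
  have h₃ : R.av c ≫ T.mor₃ = h := by
    rw [← R.av_comp_map, ← R.av_map h]
    congr 1
    rw [← cancel_mono ((ω.commShiftIso (1 : ℤ)).hom.app T.obj₁), Category.assoc, ← hc₃,
      CategoryTheory.Functor.map_id, Category.comp_id]
  have : IsIso (ω.map (R.av c)) := by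
    refine distTriang_isIso₃ hT₀' hT' (𝟙 _) (𝟙 _) _ (by simp) ?_ ?_
    · rw [← ω.map_comp, h₂, Category.id_comp]
    · rw [CategoryTheory.Functor.map_id, Category.comp_id, ← ω.map_comp_assoc, h₃]
  have : IsIso (R.av c) := isIso_of_reflects_iso _ ω
  refine isomorphic_distinguished _ hT₀ _ (Triangle.isoMk T (Triangle.mk T.mor₁ g h)
    (Iso.refl _) (Iso.refl _) (asIso (R.av c)).symm ?_ ?_ ?_)
  · exact (Category.comp_id _).trans (Category.id_comp _).symm
  · change T.mor₂ ≫ inv (R.av c) = 𝟙 _ ≫ g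
    rw [← h₂, Category.assoc, IsIso.hom_inv_id, Category.comp_id, Category.id_comp]
  · change T.mor₃ ≫ (𝟙 T.obj₁)⟦(1 : ℤ)⟧' = inv (R.av c) ≫ h
    rw [← h₃, CategoryTheory.Functor.map_id, Category.comp_id, IsIso.inv_hom_id_assoc]

omit [ω.Additive] in
include R in
-- Both classes of triangles are the class created by ω, and that class is the only data in a
-- pretriangulated structure.
lemma pretriangulated_unique [ω.ReflectsIsomorphisms] (P P' : Pretriangulated ℰ)
    (hP : letI := P; ω.IsTriangulated)
    (hP' : letI := P'; ω.IsTriangulated) : P = P' := by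
  have h : P.distinguishedTriangles = P'.distinguishedTriangles := by
    ext T
    exact (letI := P; R.mem_distTriang_iff T).trans (letI := P'; R.mem_distTriang_iff T).symm
  cases P
  cases P'
  cases h
  rfl

end Averaging

end Averaging

/-! ### Finite sums and the induction functor. -/

section Biproducts

variable {G : Type w} [Finite G] {𝒜 : Type u} [Category.{v} 𝒜] [Preadditive 𝒜]
  [HasFiniteBiproducts 𝒜]

lemma biproduct_total [Fintype G] (f : G → 𝒜) :
    ∑ g, biproduct.π f g ≫ biproduct.ι f g = 𝟙 (⨁ f) :=
  IsBilimit.total (biproduct.isBilimit f)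

lemma map_biproduct_hom_ext' {ℬ : Type u'} [Category.{v'} ℬ] [Preadditive ℬ] (Φ : 𝒜 ⥤ ℬ)
    [Φ.Additive] {f : G → 𝒜} {Y : ℬ} {a b : Φ.obj (⨁ f) ⟶ Y}
    (h : ∀ g, Φ.map (biproduct.ι f g) ≫ a = Φ.map (biproduct.ι f g) ≫ b) : a = b := by
  cases nonempty_fintype G
  rw [← Category.id_comp a, ← Category.id_comp b, ← Φ.map_id, ← biproduct_total, Φ.map_sum,
    Preadditive.sum_comp, Preadditive.sum_comp]
  refine Finset.sum_congr rfl fun g _ => ?_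
  rw [Φ.map_comp, Category.assoc, Category.assoc, h]

end Biproducts

section Induction

variable {G : Type w} [Group G] [Finite G] {𝒜 : Type u} [Category.{v} 𝒜] [Preadditive 𝒜]
  [HasFiniteBiproducts 𝒜] (A : GroupAction G 𝒜)

/-- The morphism `F_h (⨁ F_g X) ⟶ ⨁ F_g X` that permutes the summands. -/
noncomputable def indLamHom (X : 𝒜) (h : G) :
    (A.F h).obj (⨁ fun g => (A.F g).obj X) ⟶ ⨁ fun g => (A.F g).obj X :=
  biproduct.lift fun k => (A.F h).map (biproduct.π (fun g => (A.F g).obj X) (k * h⁻¹)) ≫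
    (A.δ (g := h) (h := k * h⁻¹) (inv_mul_cancel_right k h)).hom.app X

lemma indLamHom_π (X : 𝒜) {g h k : G} (e : g * h = k) :
    indLamHom A X h ≫ biproduct.π (fun g => (A.F g).obj X) k =
      (A.F h).map (biproduct.π (fun g => (A.F g).obj X) g) ≫ (A.δ e).hom.app X := by
  obtain rfl : g = k * h⁻¹ := by rw [← e, mul_inv_cancel_right]
  exact biproduct.lift_π _ _

lemma map_ι_indLamHom (X : 𝒜) {g h k : G} (e : g * h = k) :
    (A.F h).map (biproduct.ι (fun g => (A.F g).obj X) g) ≫ indLamHom A X h =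
      (A.δ e).hom.app X ≫ biproduct.ι (fun g => (A.F g).obj X) k := by
  apply biproduct.hom_ext
  intro k'
  rw [Category.assoc, Category.assoc, indLamHom_π A X (inv_mul_cancel_right k' h),
    ← Functor.map_comp_assoc]
  by_cases hk : k = k'
  · subst hk
    obtain rfl : g = k * h⁻¹ := by rw [← e, mul_inv_cancel_right]
    rw [biproduct.ι_π_self, biproduct.ι_π_self, CategoryTheory.Functor.map_id, Category.id_comp,
      Category.comp_id]
  · have hg : g ≠ k' * h⁻¹ := fun hg => hk (by rw [← e, hg, inv_mul_cancel_right])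
    rw [biproduct.ι_π_ne _ hk, biproduct.ι_π_ne _ hg, Functor.map_zero, comp_zero, zero_comp]

/-- The inverse of `indLamHom`. -/
noncomputable def indLamInv (X : 𝒜) (h : G) :
    (⨁ fun g => (A.F g).obj X) ⟶ (A.F h).obj (⨁ fun g => (A.F g).obj X) :=
  biproduct.desc fun k => (A.δ (g := h) (h := k * h⁻¹) (inv_mul_cancel_right k h)).inv.app X ≫
    (A.F h).map (biproduct.ι (fun g => (A.F g).obj X) (k * h⁻¹))

lemma ι_indLamInv (X : 𝒜) {g h k : G} (e : g * h = k) :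
    biproduct.ι (fun g => (A.F g).obj X) k ≫ indLamInv A X h =
      (A.δ e).inv.app X ≫ (A.F h).map (biproduct.ι (fun g => (A.F g).obj X) g) := by
  obtain rfl : g = k * h⁻¹ := by rw [← e, mul_inv_cancel_right]
  exact biproduct.ι_desc _ _

/-- The isomorphism `F_h (⨁ F_g X) ≅ ⨁ F_g X` that permutes the summands. -/
noncomputable def indLam (X : 𝒜) (h : G) :
    (A.F h).obj (⨁ fun g => (A.F g).obj X) ≅ ⨁ fun g => (A.F g).obj X where
  hom := indLamHom A X h
  inv := indLamInv A X h
  hom_inv_id := by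
    apply map_biproduct_hom_ext' (A.F h)
    intro g
    rw [← Category.assoc, map_ι_indLamHom A X (k := g * h) rfl, Category.assoc,
      ι_indLamInv A X rfl, Iso.hom_inv_id_app_assoc, Category.comp_id]
  inv_hom_id := by
    apply biproduct.hom_ext'
    intro k
    rw [← Category.assoc, ι_indLamInv A X (inv_mul_cancel_right k h), Category.assoc,
      map_ι_indLamHom A X (inv_mul_cancel_right k h), Iso.inv_hom_id_app_assoc, Category.comp_id]

lemma map_ι_indLam (X : 𝒜) {g h k : G} (e : g * h = k) :
    (A.F h).map (biproduct.ι (fun g => (A.F g).obj X) g) ≫ (indLam A X h).hom =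
      (A.δ e).hom.app X ≫ biproduct.ι (fun g => (A.F g).obj X) k :=
  map_ι_indLamHom A X e

lemma indLam_π (X : 𝒜) {g h k : G} (e : g * h = k) :
    (indLam A X h).hom ≫ biproduct.π (fun g => (A.F g).obj X) k =
      (A.F h).map (biproduct.π (fun g => (A.F g).obj X) g) ≫ (A.δ e).hom.app X :=
  indLamHom_π A X e

/-- The equivariant object `⨁ F_g X`. -/
noncomputable def indObj (X : 𝒜) : Equivariant A where
  obj := ⨁ fun g => (A.F g).obj X
  lam := indLam A X
  comm {g h k} e := by
    apply map_biproduct_hom_ext' (A.F h ⋙ A.F g)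
    intro a
    -- On the summand `F_a X` the condition is the cocycle identity for g, h and a, followed by
    -- naturality of δ.
    rw [Functor.comp_map, ← Functor.map_comp_assoc, map_ι_indLam A X (k := a * h) rfl,
      Functor.map_comp_assoc, map_ι_indLam A X (k := a * k) (by rw [mul_assoc, e]),
      reassoc_of% (A.cocycle (g := g) (h := h) (l := a) rfl (by rw [mul_assoc, e]) e rfl X)]
    have := (A.δ e).hom.naturality (biproduct.ι (fun g => (A.F g).obj X) a)
    rw [Functor.comp_map] at this
    rw [reassoc_of% this, map_ι_indLam A X (k := a * k) rfl]

variable {A} in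
/-- The inclusion of a summand of `⨁ F_g X`. -/
noncomputable def indι (X : 𝒜) (g : G) : (A.F g).obj X ⟶ (indObj A X).obj :=
  biproduct.ι (fun g => (A.F g).obj X) g

variable {A} in
/-- The projection to a summand of `⨁ F_g X`. -/
noncomputable def indπ (X : 𝒜) (g : G) : (indObj A X).obj ⟶ (A.F g).obj X :=
  biproduct.π (fun g => (A.F g).obj X) g

lemma indι_indπ_self (X : 𝒜) (g : G) : indι (A := A) X g ≫ indπ X g = 𝟙 _ :=
  biproduct.ι_π_self _ _

lemma indι_indπ_ne (X : 𝒜) {g h : G} (hgh : g ≠ h) : indι (A := A) X g ≫ indπ X h = 0 :=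
  biproduct.ι_π_ne _ hgh

lemma ind_total [Fintype G] (X : 𝒜) : ∑ g, indπ (A := A) X g ≫ indι X g = 𝟙 (indObj A X).obj :=
  biproduct_total _

variable {A} in
lemma map_ind_hom_ext' {ℬ : Type u'} [Category.{v'} ℬ] [Preadditive ℬ] (Φ : 𝒜 ⥤ ℬ)
    [Φ.Additive] {X : 𝒜} {Y : ℬ} {a b : Φ.obj (indObj A X).obj ⟶ Y}
    (h : ∀ g, Φ.map (indι X g) ≫ a = Φ.map (indι X g) ≫ b) : a = b :=
  map_biproduct_hom_ext' Φ h

variable {A} in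
lemma map_ind_hom_ext {ℬ : Type u'} [Category.{v'} ℬ] [Preadditive ℬ] (Φ : 𝒜 ⥤ ℬ)
    [Φ.Additive] {X : 𝒜} {Y : ℬ} {a b : Y ⟶ Φ.obj (indObj A X).obj}
    (h : ∀ g, a ≫ Φ.map (indπ X g) = b ≫ Φ.map (indπ X g)) : a = b := by
  cases nonempty_fintype G
  rw [← Category.comp_id a, ← Category.comp_id b, ← Φ.map_id, ← ind_total, Φ.map_sum,
    Preadditive.comp_sum, Preadditive.comp_sum]
  refine Finset.sum_congr rfl fun g _ => ?_
  rw [Φ.map_comp, reassoc_of% (h g)]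

variable {A} in
lemma ind_hom_ext' {X Y : 𝒜} {a b : (indObj A X).obj ⟶ Y}
    (h : ∀ g, indι X g ≫ a = indι X g ≫ b) : a = b :=
  map_ind_hom_ext' (𝟭 𝒜) h

variable {A} in
lemma ind_hom_ext {X Y : 𝒜} {a b : Y ⟶ (indObj A X).obj}
    (h : ∀ g, a ≫ indπ X g = b ≫ indπ X g) : a = b :=
  map_ind_hom_ext (𝟭 𝒜) h

lemma map_indι_lam (X : 𝒜) {g h k : G} (e : g * h = k) :
    (A.F h).map (indι X g) ≫ ((indObj A X).lam h).hom = (A.δ e).hom.app X ≫ indι X k :=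
  map_ι_indLam A X e

lemma map_indι_lam_assoc (X : 𝒜) {g h k : G} (e : g * h = k) {Z : 𝒜}
    (f : (indObj A X).obj ⟶ Z) : (A.F h).map (indι X g) ≫ ((indObj A X).lam h).hom ≫ f =
      (A.δ e).hom.app X ≫ indι X k ≫ f := by
  rw [← Category.assoc, map_indι_lam A X e, Category.assoc]

lemma lam_indπ (X : 𝒜) {g h k : G} (e : g * h = k) :
    ((indObj A X).lam h).hom ≫ indπ X k = (A.F h).map (indπ X g) ≫ (A.δ e).hom.app X :=
  indLam_π A X e

variable {A} in
/-- Morphisms out of `⨁ F_g X`. -/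
noncomputable def indDesc {X Y : 𝒜} (f : ∀ g, (A.F g).obj X ⟶ Y) : (indObj A X).obj ⟶ Y :=
  biproduct.desc f

lemma indι_desc {X Y : 𝒜} (f : ∀ g, (A.F g).obj X ⟶ Y) (g : G) : indι X g ≫ indDesc f = f g :=
  biproduct.ι_desc f g

lemma indι_desc_assoc {X Y Z : 𝒜} (f : ∀ g, (A.F g).obj X ⟶ Y) (g : G) (f' : Y ⟶ Z) :
    indι X g ≫ indDesc f ≫ f' = f g ≫ f' := by
  rw [← Category.assoc, indι_desc]

variable {A} in
/-- Morphisms into `⨁ F_g X`. -/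
noncomputable def indLift {X Y : 𝒜} (f : ∀ g, Y ⟶ (A.F g).obj X) : Y ⟶ (indObj A X).obj :=
  biproduct.lift f

lemma indLift_π {X Y : 𝒜} (f : ∀ g, Y ⟶ (A.F g).obj X) (g : G) : indLift f ≫ indπ X g = f g :=
  biproduct.lift_π f g

lemma indLift_π_assoc {X Y Z : 𝒜} (f : ∀ g, Y ⟶ (A.F g).obj X) (g : G)
    (f' : (A.F g).obj X ⟶ Z) : indLift f ≫ indπ X g ≫ f' = f g ≫ f' := by
  rw [← Category.assoc, indLift_π]

lemma indLift_indDesc [Fintype G] {X Y Z : 𝒜} (f : ∀ g, Y ⟶ (A.F g).obj X)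
    (f' : ∀ g, (A.F g).obj X ⟶ Z) : indLift f ≫ indDesc f' = ∑ g, f g ≫ f' g := by
  rw [← Category.id_comp (indDesc f'), ← ind_total, Preadditive.sum_comp, Preadditive.comp_sum]
  refine Finset.sum_congr rfl fun g _ => ?_
  rw [Category.assoc, indι_desc, indLift_π_assoc]

/-- The functoriality of `⨁ F_g X` in `X`, on underlying objects. -/
noncomputable def indMapHom {X Y : 𝒜} (f : X ⟶ Y) : (indObj A X).obj ⟶ (indObj A Y).obj :=
  biproduct.map fun g => (A.F g).map f

lemma indι_mapHom {X Y : 𝒜} (f : X ⟶ Y) (g : G) :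
    indι X g ≫ indMapHom A f = (A.F g).map f ≫ indι Y g :=
  biproduct.ι_map (fun g => (A.F g).map f) g

lemma indι_mapHom_assoc {X Y Z : 𝒜} (f : X ⟶ Y) (g : G) (f' : (indObj A Y).obj ⟶ Z) :
    indι X g ≫ indMapHom A f ≫ f' = (A.F g).map f ≫ indι Y g ≫ f' := by
  rw [← Category.assoc, indι_mapHom, Category.assoc]

lemma indMapHom_π {X Y : 𝒜} (f : X ⟶ Y) (g : G) :
    indMapHom A f ≫ indπ Y g = indπ X g ≫ (A.F g).map f :=
  biproduct.map_π (fun g => (A.F g).map f) g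

lemma indMapHom_π_assoc {X Y Z : 𝒜} (f : X ⟶ Y) (g : G) (f' : (A.F g).obj Y ⟶ Z) :
    indMapHom A f ≫ indπ Y g ≫ f' = indπ X g ≫ (A.F g).map f ≫ f' := by
  rw [← Category.assoc, indMapHom_π, Category.assoc]

/-- The functoriality of `⨁ F_g X` in `X`. -/
@[simps]
noncomputable def indMap {X Y : 𝒜} (f : X ⟶ Y) : indObj A X ⟶ indObj A Y where
  hom := indMapHom A f
  comm h := by
    apply map_ind_hom_ext' (A.F h)
    intro g
    rw [← Functor.map_comp_assoc, indι_mapHom, Functor.map_comp_assoc,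
      map_indι_lam A Y (k := g * h) rfl, map_indι_lam_assoc A X (k := g * h) rfl,
      indι_mapHom, ← Functor.comp_map, NatTrans.naturality_assoc]

lemma indMap_comp {X Y Z : 𝒜} (f : X ⟶ Y) (f' : Y ⟶ Z) :
    indMap A (f ≫ f') = indMap A f ≫ indMap A f' := by
  refine Equivariant.hom_ext (ind_hom_ext fun g => ?_)
  rw [Equivariant.comp_hom, Category.assoc, indMap_hom, indMap_hom, indMap_hom, indMapHom_π,
    indMapHom_π, indMapHom_π_assoc, Functor.map_comp]

variable {A}

/-- The unit `X ⟶ Ind (ω X)`. -/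
@[simps]
noncomputable def indUnit (X : Equivariant A) : X ⟶ indObj A X.obj where
  hom := indLift fun g => (X.lam g).inv
  comm h := by
    apply ind_hom_ext
    intro k
    rw [Category.assoc, lam_indπ A X.obj (inv_mul_cancel_right k h), ← Functor.map_comp_assoc,
      indLift_π, Category.assoc, indLift_π, Iso.eq_comp_inv, Category.assoc,
      ← X.comm, ← Functor.map_comp_assoc, Iso.inv_hom_id, CategoryTheory.Functor.map_id,
      Category.id_comp]

/-- The counit `Ind (ω X) ⟶ X`. -/
@[simps]
noncomputable def indCounit (X : Equivariant A) : indObj A X.obj ⟶ X where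
  hom := indDesc fun g => (X.lam g).hom
  comm h := by
    apply map_ind_hom_ext' (A.F h)
    intro g
    rw [map_indι_lam_assoc A X.obj (k := g * h) rfl, ← Functor.map_comp_assoc,
      indι_desc, indι_desc, X.comm]

lemma indUnit_naturality {X Y : Equivariant A} (f : X ⟶ Y) :
    f ≫ indUnit Y = indUnit X ≫ indMap A f.hom := by
  refine Equivariant.hom_ext (ind_hom_ext fun g => ?_)
  rw [Equivariant.comp_hom, Equivariant.comp_hom, indUnit_hom, indUnit_hom, indMap_hom,
    Category.assoc, Category.assoc, indLift_π, indMapHom_π, indLift_π_assoc,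
    Iso.comp_inv_eq, Category.assoc, f.comm, Iso.inv_hom_id_assoc]

lemma indCounit_naturality {X Y : Equivariant A} (f : X ⟶ Y) :
    indMap A f.hom ≫ indCounit Y = indCounit X ≫ f := by
  refine Equivariant.hom_ext (ind_hom_ext' fun g => ?_)
  rw [Equivariant.comp_hom, Equivariant.comp_hom, indCounit_hom, indCounit_hom, indMap_hom,
    indι_mapHom_assoc, indι_desc, indι_desc_assoc, f.comm]

omit [Finite G] [HasFiniteBiproducts 𝒜] in
lemma zsmul_hom (n : ℤ) {X Y : Equivariant A} (f : X ⟶ Y) : (n • f).hom = n • f.hom := rfl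

/-- Each group element contributes `λ_g⁻¹` followed by `λ_g`, that is, one identity. -/
lemma indUnit_indCounit (X : Equivariant A) :
    indUnit X ≫ indCounit X = (Nat.card G : ℤ) • 𝟙 X := by
  cases nonempty_fintype G
  ext1
  rw [Equivariant.comp_hom, indUnit_hom, indCounit_hom, indLift_indDesc, zsmul_hom]
  simp

section

variable (hG : IsInvertibleIn (Nat.card G : ℤ) 𝒜)

omit [HasFiniteBiproducts 𝒜] [Finite G] in
include hG in
-- The quotient of an equivariant morphism by |G| is again equivariant: the two sides of the
-- condition agree after multiplication by |G|, and division is unique.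
lemma isInvertibleIn_equivariant : IsInvertibleIn (Nat.card G : ℤ) (Equivariant A) := by
  intro X Y f
  obtain ⟨g, hg, hg'⟩ := hG f.hom
  dsimp only at hg hg'
  refine ⟨⟨g, fun a => ?_⟩, Equivariant.hom_ext hg, fun k hk => Equivariant.hom_ext ?_⟩
  · refine (hG ((X.lam a).hom ≫ f.hom)).unique ?_ ?_
    · rw [← Preadditive.zsmul_comp, ← Functor.map_zsmul, hg, f.comm]
    · rw [← Preadditive.comp_zsmul, hg]
  · exact hg' _ (congrArg Equivariant.Hom.hom hk)

/-- The inverse of the order of `G` as an endomorphism. -/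
noncomputable def cardInv (X : Equivariant A) : X ⟶ X :=
  (isInvertibleIn_equivariant hG (𝟙 X)).choose

omit [HasFiniteBiproducts 𝒜] [Finite G] in
lemma card_smul_cardInv (X : Equivariant A) : (Nat.card G : ℤ) • cardInv hG X = 𝟙 X :=
  (isInvertibleIn_equivariant hG (𝟙 X)).choose_spec.1

omit [HasFiniteBiproducts 𝒜] [Finite G] in
lemma cardInv_naturality {X Y : Equivariant A} (f : X ⟶ Y) :
    f ≫ cardInv hG Y = cardInv hG X ≫ f :=
  (isInvertibleIn_equivariant hG f).unique
    (by rw [← Preadditive.comp_zsmul, card_smul_cardInv, Category.comp_id])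
    (by rw [← Preadditive.zsmul_comp, card_smul_cardInv, Category.id_comp])

/-- The normalized counit, a natural retraction of the unit. -/
noncomputable def indRetraction (X : Equivariant A) : indObj A X.obj ⟶ X :=
  indCounit X ≫ cardInv hG X

lemma indUnit_indRetraction (X : Equivariant A) : indUnit X ≫ indRetraction hG X = 𝟙 X := by
  rw [indRetraction, ← Category.assoc, indUnit_indCounit, Preadditive.zsmul_comp,
    Category.id_comp, card_smul_cardInv]

lemma indRetraction_naturality {X Y : Equivariant A} (f : X ⟶ Y) :
    indMap A f.hom ≫ indRetraction hG Y = indRetraction hG X ≫ f := by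
  rw [indRetraction, indRetraction, ← Category.assoc, indCounit_naturality, Category.assoc,
    Category.assoc, cardInv_naturality]

/-- The average over the group of a morphism of underlying objects. -/
noncomputable def average {X Y : Equivariant A} (f : X.obj ⟶ Y.obj) : X ⟶ Y :=
  indUnit X ≫ indMap A f ≫ indRetraction hG Y

/-- Naturality of the unit moves `f` to the front and leaves the unit followed by its retraction. -/
lemma average_hom {X Y : Equivariant A} (f : X ⟶ Y) : average hG f.hom = f := by
  rw [average, ← Category.assoc, ← indUnit_naturality, Category.assoc, indUnit_indRetraction,
    Category.comp_id]

lemma average_hom_comp {X Y Z : Equivariant A} (f : X ⟶ Y) (f' : Y.obj ⟶ Z.obj) :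
    average hG (f.hom ≫ f') = f ≫ average hG f' := by
  rw [average, average, indMap_comp, Category.assoc, ← Category.assoc, ← indUnit_naturality,
    Category.assoc]

lemma average_comp_hom {X Y Z : Equivariant A} (f : X.obj ⟶ Y.obj) (f' : Y ⟶ Z) :
    average hG (f ≫ f'.hom) = average hG f ≫ f' := by
  rw [average, average, indMap_comp, Category.assoc, indRetraction_naturality, Category.assoc,
    Category.assoc]

/-- Averaging over the group retracts the forgetful functor on morphisms. -/
noncomputable def averaging : Averaging (forget A) where
  av f := average hG f
  av_map f := average_hom hG f
  av_map_comp f g := average_hom_comp hG f g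
  av_comp_map f g := average_comp_hom hG f g

end

end Induction

/-! ### Splitting equivariant idempotents. -/

section Splitting

variable {G : Type w} [Group G] {𝒜 : Type u} [Category.{v} 𝒜] [Preadditive 𝒜]
  {A : GroupAction G 𝒜}

/-- An idempotent of an equivariant object splits if it does so in the underlying category. -/
lemma exists_splitting_equivariant {X : Equivariant A} {Z : 𝒜} (e : X ⟶ X)
    (i : Z ⟶ X.obj) (p : X.obj ⟶ Z) (hip : i ≫ p = 𝟙 Z) (hpi : p ≫ i = e.hom) :
    ∃ (Z' : Equivariant A) (i' : Z' ⟶ X) (p' : X ⟶ Z'), i' ≫ p' = 𝟙 Z' ∧ p' ≫ i' = e := by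
  have map_ip : ∀ g, (A.F g).map i ≫ (A.F g).map p = 𝟙 _ := fun g => by
    rw [← Functor.map_comp, hip, CategoryTheory.Functor.map_id]
  have hpe : e.hom ≫ p = p := by rw [← hpi, Category.assoc, hip, Category.comp_id]
  have hie : i ≫ e.hom = i := by rw [← hpi, reassoc_of% hip]
  -- Equivariance moves the idempotent across `λ_g`. This is what makes the compression of `λ_g` to
  -- `Z` invertible and compatible with δ.
  have hl : ∀ g, (A.F g).map p ≫ (A.F g).map i ≫ (X.lam g).hom = (X.lam g).hom ≫ e.hom :=
    fun g => by rw [← Functor.map_comp_assoc, hpi, e.comm]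
  have hl' : ∀ g, (X.lam g).inv ≫ (A.F g).map p ≫ (A.F g).map i = e.hom ≫ (X.lam g).inv :=
    fun g => by
      rw [Iso.inv_comp_eq, ← Functor.map_comp, hpi, ← reassoc_of% (e.comm g), Iso.hom_inv_id,
        Category.comp_id]
  let Z' : Equivariant A :=
    { obj := Z
      lam := fun g =>
        { hom := (A.F g).map i ≫ (X.lam g).hom ≫ p
          inv := i ≫ (X.lam g).inv ≫ (A.F g).map p
          hom_inv_id := by
            simp only [Category.assoc]
            rw [reassoc_of% hpi, ← reassoc_of% (e.comm g), Iso.hom_inv_id_assoc,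
              ← Functor.map_comp, hpe, map_ip]
          inv_hom_id := by
            simp only [Category.assoc]
            rw [reassoc_of% (hl g), Iso.inv_hom_id_assoc, hpe, hip] }
      comm := fun {g h k} eq => by
        have := (A.δ eq).hom.naturality i
        rw [Functor.comp_map] at this
        simp only [Functor.map_comp, Category.assoc]
        rw [reassoc_of% (hl g), hpe, reassoc_of% (X.comm eq), reassoc_of% this] }
  refine ⟨Z', ⟨i, fun g => ?_⟩, ⟨p, fun g => ?_⟩, Equivariant.hom_ext hip, Equivariant.hom_ext hpi⟩
  · change _ = ((A.F g).map i ≫ (X.lam g).hom ≫ p) ≫ i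
    rw [Category.assoc, Category.assoc, hpi, ← e.comm, ← Functor.map_comp_assoc, hie]
  · change _ ≫ (A.F g).map i ≫ (X.lam g).hom ≫ p = _
    rw [reassoc_of% (hl g), hpe]

end Splitting

/-! ### Morphisms with cone in C, and their induction. -/

section TrW

variable {𝒟 : Type u} [Category.{v} 𝒟] [Preadditive 𝒟] [HasShift 𝒟 ℤ]
  [HasZeroObject 𝒟] [∀ n : ℤ, (shiftFunctor 𝒟 n).Additive] [Pretriangulated 𝒟]
  {ℬ : Type u'} [Category.{v'} ℬ] [Preadditive ℬ] [HasShift ℬ ℤ]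
  [HasZeroObject ℬ] [∀ n : ℤ, (shiftFunctor ℬ n).Additive] [Pretriangulated ℬ]

lemma trW_map_of_le (F : 𝒟 ⥤ ℬ) [F.CommShift ℤ] [F.IsTriangulated] {C : ObjectProperty 𝒟}
    {C' : ObjectProperty ℬ} (h : ∀ X, C X → C' (F.obj X)) {X Y : 𝒟} {s : X ⟶ Y}
    (hs : C.trW s) : C'.trW (F.map s) := by
  obtain ⟨Z, a, b, hT, hZ⟩ := hs
  exact ObjectProperty.trW.mk (P := C') (F.map_distinguished _ hT) (h _ hZ)

/-- A product of distinguished triangles is distinguished, so the cone is the finite product of the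
cones, and C contains it. -/
lemma trW_biproduct_map {J : Type w} [Finite J] (C : ObjectProperty 𝒟) [C.IsTriangulated]
    [C.IsClosedUnderIsomorphisms] {X Y : J → 𝒟} (f : ∀ j, X j ⟶ Y j) (hf : ∀ j, C.trW (f j)) :
    C.trW (biproduct.map f) := by
  choose Z a b hT hZ using hf
  have : C.IsClosedUnderLimitsOfShape (Discrete J) :=
    ObjectProperty.IsClosedUnderLimitsOfShape.of_equivalence
      (Discrete.equivalence (Finite.equivFin J).symm)
  have h : C.trW (Limits.Pi.map f) :=
    ObjectProperty.trW.mk (P := C) (productTriangle_distinguished _ hT) (C.prop_pi _ hZ)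
  refine (C.trW.arrow_mk_iso_iff
    (Arrow.isoMk (biproduct.isoProduct X) (biproduct.isoProduct Y) ?_)).2 h
  change _ ≫ Limits.Pi.map f = biproduct.map f ≫ _
  rw [biproduct.isoProduct_hom, biproduct.isoProduct_hom]
  refine Limits.Pi.hom_ext _ _ fun j => ?_
  rw [Category.assoc, Category.assoc, Limits.Pi.map_π, Limits.Pi.lift_π_assoc, Limits.Pi.lift_π,
    biproduct.map_π]

variable {G : Type w} [Group G] [Finite G] {A : GroupAction G 𝒟} [A.ShiftStructure]
  [A.IsAdmissible] [Pretriangulated (Equivariant A)] [(forget A).IsTriangulated]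
  {C : ObjectProperty 𝒟} [C.IsTriangulated] [C.IsClosedUnderIsomorphisms]

/-- This makes denominators of 𝒟/C usable in 𝒟^G/C^G: after forgetting, Ind s is the sum of the
F_g(s), whose cones lie in C by invariance. -/
lemma trW_indMap (hC : A.Invariant C) {X Y : 𝒟} {s : X ⟶ Y} (hs : C.trW s) :
    (equivariantSubcategory A C).trW (indMap A s) := by
  rw [equivariantSubcategory, C.inverseImage_trW_iff]
  exact trW_biproduct_map C _ fun g => trW_map_of_le (A.F g) (hC g) hs

end TrW

/-! ### Equivariant functors and induction. -/

section EquivariantFunctor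

variable {G : Type w} [Group G] {𝒜 : Type u} [Category.{v} 𝒜] [Preadditive 𝒜]
  {ℬ : Type u'} [Category.{v'} ℬ] [Preadditive ℬ]
  {A : GroupAction G 𝒜} {B : GroupAction G ℬ} {Φ : 𝒜 ⥤ ℬ} (S : EquivariantStructure A B Φ)

namespace EquivariantStructure

instance [Φ.Additive] : S.map.Additive where
  map_add {_ _ f g} := Equivariant.hom_ext (Φ.map_add (f := f.hom) (g := g.hom))

lemma map_hom_comm {X Y : Equivariant A} (h : S.map.obj X ⟶ S.map.obj Y) (g : G) :
    (B.F g).map (X := Φ.obj X.obj) (Y := Φ.obj Y.obj) h.hom ≫ (S.φ g).inv.app Y.obj ≫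
      Φ.map (Y.lam g).hom = (S.φ g).inv.app X.obj ≫ Φ.map (X.lam g).hom ≫ h.hom :=
  (h.comm g).trans (Category.assoc _ _ _)

variable [Finite G] [HasFiniteBiproducts 𝒜] [Φ.Additive]

/-- An equivariant morphism `h` between the images of `X` and `Y` that becomes `Φ a` after
composition with `Φ s` is induced by `Ind a` and `Ind s`. -/
lemma comp_map_indUnit_indMap {X Y : Equivariant A} {Z : 𝒜} (h : S.map.obj X ⟶ S.map.obj Y)
    (a : X.obj ⟶ Z) (s : Y.obj ⟶ Z)
    (e : (show Φ.obj X.obj ⟶ Φ.obj Y.obj from h.hom) ≫ Φ.map s = Φ.map a) :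
    h ≫ S.map.map (indUnit Y ≫ indMap A s) = S.map.map (indUnit X ≫ indMap A a) := by
  have hc := S.map_hom_comm h
  refine Equivariant.hom_ext (map_ind_hom_ext Φ fun g => ?_)
  obtain ⟨h', hh'⟩ : ∃ h' : Φ.obj X.obj ⟶ Φ.obj Y.obj, h' = h.hom := ⟨h.hom, rfl⟩
  replace e : h' ≫ Φ.map s = Φ.map a := by rw [hh']; exact e
  replace hc : (B.F g).map h' ≫ (S.φ g).inv.app Y.obj ≫ Φ.map (Y.lam g).hom =
      (S.φ g).inv.app X.obj ≫ Φ.map (X.lam g).hom ≫ h' := by rw [hh']; exact hc g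
  -- This is the equivariance of `h` solved for the inverses of `λ_g`, which are the components of
  -- the unit.
  have h₁ : h' ≫ Φ.map (Y.lam g).inv ≫ (S.φ g).hom.app Y.obj =
      Φ.map (X.lam g).inv ≫ (S.φ g).hom.app X.obj ≫ (B.F g).map h' := by
    rw [← cancel_epi (Φ.map (X.lam g).hom), ← cancel_epi ((S.φ g).inv.app X.obj),
      ← reassoc_of% hc, ← Functor.map_comp_assoc, ← Functor.map_comp_assoc]
    simp
  have h₂ := (S.φ g).hom.naturality s
  have h₃ := (S.φ g).hom.naturality a
  simp only [Functor.comp_map] at h₂ h₃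
  have h₄ : ∀ {W : Equivariant A} (b : W.obj ⟶ Z), Φ.map (indUnit W ≫ indMap A b).hom ≫
      Φ.map (indπ Z g) = Φ.map (W.lam g).inv ≫ Φ.map ((A.F g).map b) := fun b => by
    rw [← Φ.map_comp, ← Φ.map_comp, Equivariant.comp_hom, indMap_hom, Category.assoc,
      indMapHom_π, indUnit_hom, indLift_π_assoc]
  have : h' ≫ Φ.map (indUnit Y ≫ indMap A s).hom ≫ Φ.map (indπ Z g) =
      Φ.map (indUnit X ≫ indMap A a).hom ≫ Φ.map (indπ Z g) := by
    rw [h₄, h₄, ← cancel_mono ((S.φ g).hom.app Z), Category.assoc, Category.assoc, Category.assoc,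
      h₂, h₃, reassoc_of% h₁, ← (B.F g).map_comp, e]
  rw [hh'] at this
  exact (Category.assoc _ _ _).trans this

variable [HasFiniteBiproducts ℬ]

/-- The comparison of the induction functors. -/
noncomputable def mapIndHom (X : 𝒜) : S.map.obj (indObj A X) ⟶ indObj B (Φ.obj X) where
  hom := indLift (Y := Φ.obj (indObj A X).obj) fun g => Φ.map (indπ X g) ≫ (S.φ g).hom.app X
  comm h := by
    have key : (B.F h).map (indLift (Y := Φ.obj (indObj A X).obj)
        fun g => Φ.map (indπ X g) ≫ (S.φ g).hom.app X) ≫ ((indObj B (Φ.obj X)).lam h).hom =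
        (S.φ h).inv.app (indObj A X).obj ≫ Φ.map ((indObj A X).lam h).hom ≫
          indLift (Y := Φ.obj (indObj A X).obj)
            fun g => Φ.map (indπ X g) ≫ (S.φ g).hom.app X := by
      refine ind_hom_ext fun k => ?_
      have e := inv_mul_cancel_right k h
      have h₁ := (S.φ h).hom.naturality (indπ (A := A) X (k * h⁻¹))
      simp only [Functor.comp_map] at h₁
      rw [Category.assoc, Category.assoc, Category.assoc, lam_indπ B (Φ.obj X) e, indLift_π,
        ← Functor.map_comp_assoc, indLift_π, ← cancel_epi ((S.φ h).hom.app (indObj A X).obj),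
        Iso.hom_inv_id_app_assoc, ← Φ.map_comp_assoc, lam_indπ A X e, Φ.map_comp_assoc, S.comm e,
        reassoc_of% h₁, Functor.map_comp_assoc]
    exact key.trans (Category.assoc _ _ _).symm

/-- Forgetting reflects isomorphisms, and on underlying objects the map is `φ_g` on each summand. -/
instance (X : 𝒜) : IsIso (S.mapIndHom X) := by
  have : IsIso ((forget B).map (S.mapIndHom X)) := by
    refine ⟨indDesc (Y := Φ.obj (indObj A X).obj)
      fun g => (S.φ g).inv.app X ≫ Φ.map (indι X g), ?_, ?_⟩
    · change indLift (Y := Φ.obj (indObj A X).obj) _ ≫ indDesc _ = 𝟙 (Φ.obj (indObj A X).obj)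
      cases nonempty_fintype G
      rw [indLift_indDesc, ← Φ.map_id, ← ind_total, Φ.map_sum]
      refine Finset.sum_congr rfl fun g _ => ?_
      rw [Category.assoc, Iso.hom_inv_id_app_assoc, Φ.map_comp]
    · change indDesc _ ≫ indLift (Y := Φ.obj (indObj A X).obj) _ = 𝟙 (indObj B (Φ.obj X)).obj
      refine ind_hom_ext fun k => ind_hom_ext' fun g => ?_
      rw [Category.assoc, indLift_π, indι_desc_assoc, Category.id_comp, Category.assoc,
        ← Φ.map_comp_assoc]
      by_cases hg : g = k
      · subst hg
        rw [indι_indπ_self, indι_indπ_self, Φ.map_id, Category.id_comp, Iso.inv_hom_id_app]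
        rfl
      · rw [indι_indπ_ne _ _ hg, indι_indπ_ne _ _ hg, Φ.map_zero, zero_comp, comp_zero]
  exact isIso_of_reflects_iso _ (forget B)

end EquivariantStructure

end EquivariantFunctor

/-! ### Density of the induced objects. -/

section Dense

variable {G : Type w} [Group G] [Finite G] {𝒜 : Type u} [Category.{v} 𝒜] [Preadditive 𝒜]
  [HasFiniteBiproducts 𝒜] {ℬ : Type u'} [Category.{v'} ℬ] [Preadditive ℬ] [HasFiniteBiproducts ℬ]
  {A : GroupAction G 𝒜} {B : GroupAction G ℬ} {Φ : 𝒜 ⥤ ℬ} [Φ.Additive]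

variable (A) in
lemma indMap_id (X : 𝒜) : indMap A (𝟙 X) = 𝟙 (indObj A X) := by
  refine Equivariant.hom_ext (ind_hom_ext fun g => ?_)
  rw [indMap_hom, indMapHom_π, CategoryTheory.Functor.map_id, Category.comp_id,
    Equivariant.id_hom, Category.id_comp]

/-- `Y` is a retract of Ind ωY; with ωY ≅ ΦX this is Ind ΦX, which is isomorphic to Φ^G(Ind X). -/
lemma EquivariantStructure.exists_retract_map_ind [Φ.EssSurj] (S : EquivariantStructure A B Φ)
    (hG : IsInvertibleIn (Nat.card G : ℤ) ℬ) (Y : Equivariant B) :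
    ∃ X : 𝒜, Nonempty (Retract Y (S.map.obj (indObj A X))) := by
  let e := Φ.objObjPreimageIso Y.obj
  have he : indMap B e.inv ≫ indMap B e.hom = 𝟙 _ := by
    rw [← indMap_comp, e.inv_hom_id, indMap_id]
  exact ⟨Φ.objPreimage Y.obj, ⟨⟨indUnit Y ≫ indMap B e.inv ≫ inv (S.mapIndHom _),
    S.mapIndHom _ ≫ indMap B e.hom ≫ indRetraction hG Y, by
      simp only [Category.assoc, IsIso.inv_hom_id_assoc]
      rw [reassoc_of% he, indUnit_indRetraction]⟩⟩⟩

omit [HasFiniteBiproducts 𝒜] [HasFiniteBiproducts ℬ] in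
variable (Φ) in
-- It suffices to divide identities by n, and these divisions are transported from preimages of
-- objects; no fullness is required.
lemma isInvertibleIn_of_essSurj [Φ.EssSurj] {n : ℤ} (h : IsInvertibleIn n 𝒜) :
    IsInvertibleIn n ℬ := by
  have h' : ∀ Y : ℬ, ∃ c : Y ⟶ Y, n • c = 𝟙 Y := fun Y => by
    obtain ⟨c, hc, -⟩ := h (𝟙 (Φ.objPreimage Y))
    let e := Φ.objObjPreimageIso Y
    refine ⟨e.inv ≫ Φ.map c ≫ e.hom, ?_⟩
    rw [← Preadditive.comp_zsmul, ← Preadditive.zsmul_comp, ← Φ.map_zsmul, hc, Φ.map_id,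
      Category.id_comp, e.inv_hom_id]
  intro X Y f
  obtain ⟨c, hc⟩ := h' X
  refine ⟨c ≫ f, ?_, fun g hg => ?_⟩
  · change n • (c ≫ f) = f
    rw [← Preadditive.zsmul_comp, hc, Category.id_comp]
  · dsimp only at hg
    rw [← hg, Preadditive.comp_zsmul, ← Preadditive.zsmul_comp, hc, Category.id_comp]

end Dense

/-! ### The comparison functor is an equivalence up to retracts. -/

section Comparison

variable {G : Type w} [Group G] {𝒟 : Type u} [Category.{v} 𝒟] [Preadditive 𝒟] [HasShift 𝒟 ℤ]
  [HasZeroObject 𝒟] [∀ n : ℤ, (shiftFunctor 𝒟 n).Additive] [Pretriangulated 𝒟]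
  [IsTriangulated 𝒟] {A : GroupAction G 𝒟} [A.ShiftStructure]
  [P : Pretriangulated (Equivariant A)] [IsCanonicalTriangulated A P]
  {C : ObjectProperty 𝒟} [C.IsTriangulated] [C.IsClosedUnderIsomorphisms] (I : InducedAction A C)

/-- The comparison functor extends `Q^G`. -/
noncomputable def comparisonIso :
    verdierQ (equivariantSubcategory A C) ⋙ comparison I ≅ I.equivQ.map :=
  Localization.Lifting.iso (verdierQ (equivariantSubcategory A C))
    (equivariantSubcategory A C).trW I.equivQ.map (comparison I)

instance : (comparison I).Additive := by
  rw [Localization.functor_additive_iff (verdierQ (equivariantSubcategory A C))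
    (equivariantSubcategory A C).trW]
  exact Functor.additive_of_iso (comparisonIso I).symm

variable [Finite G] [A.IsAdmissible]

/-- If `f` dies in 𝒟/C, some s with cone in C kills it, so `f` followed by the unit and Ind s
vanishes. In 𝒟^G/C^G, Ind s is invertible and the unit is a split monomorphism. -/
lemma comparison_faithful (hG : IsInvertibleIn (Nat.card G : ℤ) 𝒟) (hC : A.Invariant C) :
    (comparison I).Faithful := by
  refine Functor.faithful_of_comp_cancel_zero_of_hasLeftCalculusOfFractions
    (verdierQ (equivariantSubcategory A C)) (equivariantSubcategory A C).trW _ ?_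
  intro X Y f hf
  have h₀ : I.equivQ.map.map f = 0 := by
    have := (comparisonIso I).hom.naturality f
    rw [Functor.comp_map, hf, zero_comp] at this
    rw [← cancel_epi ((comparisonIso I).hom.app X), ← this, comp_zero]
  have h₁ : (verdierQ C).map f.hom = (verdierQ C).map 0 := by
    rw [Functor.map_zero]
    exact congrArg Equivariant.Hom.hom h₀
  rw [MorphismProperty.map_eq_iff_postcomp (verdierQ C) C.trW] at h₁
  obtain ⟨Z, s, hs, hfs⟩ := h₁
  have := Localization.inverts (verdierQ (equivariantSubcategory A C))
    (equivariantSubcategory A C).trW _ (trW_indMap hC hs)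
  have h₂ : f ≫ indUnit Y ≫ indMap A s = 0 := by
    refine Equivariant.hom_ext (ind_hom_ext fun g => ?_)
    rw [← Category.assoc, indUnit_naturality, Category.assoc, ← indMap_comp, hfs, zero_comp,
      Equivariant.comp_hom, indMap_hom, Category.assoc, indMapHom_π, Functor.map_zero, comp_zero,
      comp_zero, Equivariant.zero_hom, zero_comp]
  have h₃ := congrArg (verdierQ (equivariantSubcategory A C)).map h₂
  rw [← Category.assoc, Functor.map_comp, Functor.map_zero, Preadditive.IsIso.comp_right_eq_zero]
    at h₃
  rw [← Category.comp_id f, ← indUnit_indRetraction hG Y, ← Category.assoc, Functor.map_comp,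
    h₃, zero_comp]

/-- An equivariant `h` is represented in 𝒟/C by a roof that need not be equivariant. The induced
roof represents `h` followed by the unit, and the retraction of the unit recovers `h`. -/
lemma comparison_full (hG : IsInvertibleIn (Nat.card G : ℤ) 𝒟) (hC : A.Invariant C) :
    (comparison I).Full := by
  have key : ∀ {X Y : Equivariant A} (h : I.equivQ.map.obj X ⟶ I.equivQ.map.obj Y),
      ∃ k : (verdierQ (equivariantSubcategory A C)).obj X ⟶
        (verdierQ (equivariantSubcategory A C)).obj Y,
        (comparison I).map k ≫ (comparisonIso I).hom.app Y =
          (comparisonIso I).hom.app X ≫ h := by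
    intro X Y h
    obtain ⟨φ, hφ⟩ := Localization.exists_leftFraction (verdierQ C) C.trW
      (show (verdierQ C).obj X.obj ⟶ (verdierQ C).obj Y.obj from h.hom)
    have := Localization.inverts (verdierQ (equivariantSubcategory A C))
      (equivariantSubcategory A C).trW _ (trW_indMap hC φ.hs)
    have e := I.equivQ.comp_map_indUnit_indMap h φ.f φ.s (by
      rw [hφ, MorphismProperty.LeftFraction.map_comp_map_s])
    have hs : IsIso (I.equivQ.map.map (indMap A φ.s)) := I.inverts _ (trW_indMap hC φ.hs)
    have hK : ∀ {X Y : Equivariant A} (f : X ⟶ Y),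
        (comparison I).map ((verdierQ (equivariantSubcategory A C)).map f) ≫
          (comparisonIso I).hom.app Y = (comparisonIso I).hom.app X ≫ I.equivQ.map.map f :=
      fun f => (comparisonIso I).hom.naturality f
    let k := (verdierQ (equivariantSubcategory A C)).map (indUnit X ≫ indMap A φ.f) ≫
      inv ((verdierQ (equivariantSubcategory A C)).map (indMap A φ.s))
    have hk : (comparison I).map k ≫ (comparisonIso I).hom.app (indObj A Y.obj) =
        (comparisonIso I).hom.app X ≫ h ≫ I.equivQ.map.map (indUnit Y) := by
      rw [← cancel_mono (I.equivQ.map.map (indMap A φ.s)), Category.assoc, Category.assoc,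
        Category.assoc, ← hK, ← Functor.map_comp_assoc, Category.assoc, IsIso.inv_hom_id,
        Category.comp_id, ← Functor.map_comp, e, hK]
    refine ⟨k ≫ (verdierQ (equivariantSubcategory A C)).map (indRetraction hG Y), ?_⟩
    rw [Functor.map_comp_assoc, hK, reassoc_of% hk, ← Functor.map_comp, indUnit_indRetraction,
      CategoryTheory.Functor.map_id, Category.comp_id]
  -- Arbitrary objects of the quotient are reduced to images of objects of 𝒟^G.
  have : (verdierQ (equivariantSubcategory A C)).EssSurj :=
    Localization.essSurj _ (equivariantSubcategory A C).trW
  refine ⟨fun {X Y} f => ?_⟩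
  let eX := (verdierQ (equivariantSubcategory A C)).objObjPreimageIso X
  let eY := (verdierQ (equivariantSubcategory A C)).objObjPreimageIso Y
  obtain ⟨k, hk⟩ := key ((comparisonIso I).inv.app _ ≫ (comparison I).map eX.hom ≫ f ≫
    (comparison I).map eY.inv ≫ (comparisonIso I).hom.app _)
  refine ⟨eX.inv ≫ k ≫ eY.hom, ?_⟩
  rw [Iso.hom_inv_id_app_assoc, ← Category.assoc, ← Category.assoc, cancel_mono] at hk
  rw [Functor.map_comp, Functor.map_comp, hk, Category.assoc, Category.assoc,
    ← Functor.map_comp, eY.inv_hom_id, CategoryTheory.Functor.map_id, Category.comp_id,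
    ← Functor.map_comp_assoc,
    eX.inv_hom_id, CategoryTheory.Functor.map_id, Category.id_comp]

omit [A.IsAdmissible] in
lemma comparison_dense (hG : IsInvertibleIn (Nat.card G : ℤ) 𝒟) (Y : Equivariant I.action) :
    ∃ Z, (comparison I).essImage Z ∧ Nonempty (Retract Y Z) := by
  have : (verdierQ C).EssSurj := Localization.essSurj _ C.trW
  obtain ⟨X, hX⟩ := I.equivQ.exists_retract_map_ind (isInvertibleIn_of_essSurj (verdierQ C) hG) Y
  exact ⟨_, ⟨_, ⟨(comparisonIso I).app (indObj A X)⟩⟩, hX⟩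

lemma comparison_isEquivalenceUpToRetracts (hG : IsInvertibleIn (Nat.card G : ℤ) 𝒟)
    (hC : A.Invariant C) : IsEquivalenceUpToRetracts (comparison I) where
  full := comparison_full I hG hC
  faithful := comparison_faithful I hG hC
  dense := comparison_dense I hG

end Comparison

/-- The idempotent cutting out a retract of Φ X lifts to X by full faithfulness; a splitting of the
lift maps to the retract. -/
lemma IsEquivalenceUpToRetracts.isEquivalence {𝒜 : Type u} [Category.{v} 𝒜] {ℬ : Type u'}
    [Category.{v'} ℬ] {Φ : 𝒜 ⥤ ℬ} (h : IsEquivalenceUpToRetracts Φ) [IsIdempotentComplete 𝒜] :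
    Φ.IsEquivalence := by
  have := h.full
  have := h.faithful
  have : Φ.EssSurj := ⟨fun Y => by
    obtain ⟨_, ⟨X, ⟨e⟩⟩, ⟨r⟩⟩ := h.dense Y
    obtain ⟨p, hp⟩ := Φ.map_surjective (e.hom ≫ r.r ≫ r.i ≫ e.inv)
    obtain ⟨X', i, q, hiq, hqi⟩ := IsIdempotentComplete.idempotents_split X p
      (Φ.map_injective (by simp [hp]))
    refine ⟨X', ⟨⟨Φ.map i ≫ e.hom ≫ r.r, r.i ≫ e.inv ≫ Φ.map q, ?_, ?_⟩⟩⟩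
    · have : Φ.map q ≫ Φ.map i = e.hom ≫ r.r ≫ r.i ≫ e.inv := by rw [← Φ.map_comp, hqi, hp]
      have h₁ : Φ.map i ≫ Φ.map q = 𝟙 _ := by rw [← Φ.map_comp, hiq, Φ.map_id]
      simp only [Category.assoc]
      rw [← reassoc_of% this, h₁, Category.comp_id, h₁]
    · have : Φ.map q ≫ Φ.map i = e.hom ≫ r.r ≫ r.i ≫ e.inv := by rw [← Φ.map_comp, hqi, hp]
      simp only [Category.assoc]
      rw [reassoc_of% this]
      simp⟩
  exact { }

/-! ### The canonical triangulated structure on (𝒟/C)^G. -/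

section Canonical

variable {G : Type w} [Group G] {𝒟 : Type u} [Category.{v} 𝒟] [Preadditive 𝒟] [HasShift 𝒟 ℤ]
  [HasZeroObject 𝒟] [∀ n : ℤ, (shiftFunctor 𝒟 n).Additive] [Pretriangulated 𝒟]
  [IsTriangulated 𝒟] {A : GroupAction G 𝒟} [A.ShiftStructure]
  [P : Pretriangulated (Equivariant A)] [IsCanonicalTriangulated A P]
  {C : ObjectProperty 𝒟} [C.IsTriangulated] [C.IsClosedUnderIsomorphisms] (I : InducedAction A C)

omit P [IsCanonicalTriangulated A P] [C.IsClosedUnderIsomorphisms] in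
/-- The functor `Q^G` is `Q` on underlying objects. -/
noncomputable def equivQCompForgetIso :
    forget A ⋙ verdierQ C ≅ I.equivQ.map ⋙ forget I.action :=
  Iso.refl _

omit P [IsCanonicalTriangulated A P] [C.IsClosedUnderIsomorphisms] in
instance : NatTrans.CommShift (equivQCompForgetIso I).hom ℤ where
  shift_comm n := by
    ext X
    have h : ((verdierQ C).map (𝟙 (X.obj⟦n⟧)) ≫ ((verdierQ C).commShiftIso n).hom.app X.obj) ≫
        (𝟙 ((verdierQ C).obj X.obj))⟦n⟧' =
      𝟙 ((verdierQ C).obj (X.obj⟦n⟧)) ≫ ((verdierQ C).commShiftIso n).hom.app X.obj ≫ 𝟙 _ := by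
      simp
    rw [NatTrans.comp_app, NatTrans.comp_app, Functor.commShiftIso_comp_hom_app,
      Functor.commShiftIso_comp_hom_app]
    exact h

instance : (I.equivQ.map ⋙ forget I.action).IsTriangulated :=
  Functor.isTriangulated_of_iso (equivQCompForgetIso I)

instance : NatTrans.CommShift (comparisonIso I).hom ℤ :=
  NatTrans.commShift_iso_hom_of_localization (verdierQ (equivariantSubcategory A C))
    (equivariantSubcategory A C).trW ℤ I.equivQ.map (comparison I)

/-- Arrows of 𝒟^G/C^G come, up to isomorphism, from 𝒟^G, so exactness may be tested after
precomposing with the quotient functor. The result is Q after the forgetful functor. -/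
instance : (comparison I ⋙ forget I.action).IsTriangulated := by
  have : (verdierQ (equivariantSubcategory A C)).mapArrow.EssSurj :=
    Localization.essSurj_mapArrow _ (equivariantSubcategory A C).trW
  let e : verdierQ (equivariantSubcategory A C) ⋙ comparison I ⋙ forget I.action ≅
      I.equivQ.map ⋙ forget I.action :=
    (Functor.associator _ _ _).symm ≪≫ Functor.isoWhiskerRight (comparisonIso I) (forget I.action)
  have : NatTrans.CommShift e.hom ℤ := by
    dsimp only [e, Iso.trans_hom, Iso.symm_hom, Functor.isoWhiskerRight_hom]
    infer_instance
  exact Functor.isTriangulated_of_precomp_iso e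

/-- This replaces exactness of the comparison functor as long as (𝒟/C)^G has no triangulated
structure. -/
lemma forget_map_comparison_distinguished
    {T : Triangle (VerdierQuotient (equivariantSubcategory A C))} (hT : T ∈ distTriang _) :
    (forget I.action).mapTriangle.obj ((comparison I).mapTriangle.obj T) ∈ distTriang _ :=
  isomorphic_distinguished _ ((comparison I ⋙ forget I.action).map_distinguished T hT) _
    ((Functor.mapTriangleCompIso (comparison I) (forget I.action)).symm.app T)

variable [Finite G] [A.IsAdmissible]

/-- By density the source and target are retracts of objects in the image, and by fullness the
morphism is a retract of one in the image, whose cone is already available. -/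
lemma exists_cone_equivariant (hG : IsInvertibleIn (Nat.card G : ℤ) 𝒟) (hC : A.Invariant C)
    {X Y : Equivariant I.action} (f : X ⟶ Y) :
    ∃ (Z : Equivariant I.action) (g : Y ⟶ Z) (h : Z ⟶ X⟦(1 : ℤ)⟧),
      (forget I.action).mapTriangle.obj (Triangle.mk f g h) ∈ distTriang _ := by
  have := comparison_full I hG hC
  have : (verdierQ C).EssSurj := Localization.essSurj _ C.trW
  have hG' := isInvertibleIn_of_essSurj (verdierQ C) hG
  have hr : ∀ Z : Equivariant I.action, ∃ T, Nonempty (Retract Z ((comparison I).obj T)) := by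
    intro Z
    obtain ⟨_, ⟨T, ⟨e⟩⟩, ⟨r⟩⟩ := comparison_dense I hG Z
    exact ⟨T, ⟨r.trans (Retract.ofIso e.symm)⟩⟩
  obtain ⟨T₁, ⟨r₁⟩⟩ := hr X
  obtain ⟨T₂, ⟨r₂⟩⟩ := hr Y
  obtain ⟨f₀, hf₀⟩ := (comparison I).map_surjective (r₁.r ≫ f ≫ r₂.i)
  obtain ⟨T₃, g₀, h₀, hT⟩ := distinguished_cocone_triangle f₀
  exact (averaging hG').exists_cone_of_retract
    (fun e i p hip hpi => exists_splitting_equivariant e i p hip hpi) r₁ r₂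
    (f' := (comparison I).map f₀) (by rw [hf₀, r₁.retract_assoc])
    (by rw [hf₀, Category.assoc, Category.assoc, r₂.retract, Category.comp_id])
    (forget_map_comparison_distinguished I hT)

omit [A.IsAdmissible] in
-- Distinguished triangles of the target are detected by forgetting.
lemma comparison_isTriangulated (hG : IsInvertibleIn (Nat.card G : ℤ) 𝒟)
    [Pretriangulated (Equivariant I.action)] [(forget I.action).IsTriangulated] :
    (comparison I).IsTriangulated where
  map_distinguished T hT := by
    have : (verdierQ C).EssSurj := Localization.essSurj _ C.trW
    rw [(averaging (isInvertibleIn_of_essSurj (verdierQ C) hG)).mem_distTriang_iff]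
    exact forget_map_comparison_distinguished I hT

lemma existsUnique_isCanonicalTriangulated (hG : IsInvertibleIn (Nat.card G : ℤ) 𝒟)
    (hC : A.Invariant C) :
    ∃! P' : Pretriangulated (Equivariant I.action), IsCanonicalTriangulated I.action P' := by
  have : (verdierQ C).EssSurj := Localization.essSurj _ C.trW
  have hG' := isInvertibleIn_of_essSurj (verdierQ C) hG
  let P₀ := (averaging hG').pretriangulated (exists_cone_equivariant I hG hC)
  have h : (forget I.action).IsTriangulated := ⟨fun T hT => hT⟩
  have := comparison_full I hG hC
  have := comparison_isTriangulated I hG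
  exact ⟨P₀, ⟨isTriangulated_of_dense (comparison I) (comparison_dense I hG), h⟩,
    fun P' hP' => (averaging hG').pretriangulated_unique _ _ hP'.isTriangulated_forget h⟩

end Canonical

/-! ### Descent of the action to a localization. -/

section QuotientAction

/-- A natural transformation commutes with shifts if it does so after composition with a
localization functor. -/
lemma commShift_of_whiskerLeft {𝒜 : Type*} [Category* 𝒜] {ℒ : Type*} [Category* ℒ]
    {ℬ : Type*} [Category* ℬ] [HasShift 𝒜 ℤ] [HasShift ℒ ℤ] [HasShift ℬ ℤ] (L : 𝒜 ⥤ ℒ)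
    [L.CommShift ℤ] (W : MorphismProperty 𝒜) [L.IsLocalization W] {F F' : ℒ ⥤ ℬ} [F.CommShift ℤ]
    [F'.CommShift ℤ] (τ : F ⟶ F') [NatTrans.CommShift (Functor.whiskerLeft L τ) ℤ] :
    NatTrans.CommShift τ ℤ where
  shift_comm n := by
    refine Localization.natTrans_ext L W fun X => ?_
    have h := NatTrans.shift_app_comm (Functor.whiskerLeft L τ) n X
    rw [Functor.commShiftIso_comp_hom_app, Functor.commShiftIso_comp_hom_app,
      Functor.whiskerLeft_app, Functor.whiskerLeft_app, ← NatTrans.naturality_assoc,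
      Category.assoc, cancel_epi] at h
    exact h

variable {G : Type w} [Group G] {𝒜 : Type u} [Category.{v} 𝒜] [Preadditive 𝒜]

/-- The neutral element acts trivially, up to isomorphism. -/
noncomputable def GroupAction.oneIso (A : GroupAction G 𝒜) : A.F 1 ≅ 𝟭 𝒜 :=
  -- No unit is part of an action: it is obtained from F_1 F_1 ≅ F_1 by cancelling the fully
  -- faithful functor F_1.
  Functor.fullyFaithfulCancelRight (A.F 1) (A.δ (one_mul 1) ≪≫ (Functor.leftUnitor _).symm)

variable (A : GroupAction G 𝒜) (W : MorphismProperty 𝒜)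
  (hW : ∀ g : G, W ≤ W.inverseImage (A.F g))

include hW in
lemma isInvertedBy_F_comp_Q (g : G) : W.IsInvertedBy (A.F g ⋙ W.Q) := fun _ _ s hs =>
  Localization.inverts W.Q W _ (hW g s hs)

/-- The functor induced by `F_g` on the localization. -/
noncomputable def locF (g : G) : W.Localization ⥤ W.Localization :=
  Localization.lift (A.F g ⋙ W.Q) (isInvertedBy_F_comp_Q A W hW g) W.Q

noncomputable instance (g : G) : Localization.Lifting W.Q W (A.F g ⋙ W.Q) (locF A W hW g) :=
  inferInstanceAs (Localization.Lifting _ _ _ (Localization.lift _ _ _))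

/-- The functor `locF` extends `F_g`. -/
noncomputable def locIso (g : G) : A.F g ⋙ W.Q ≅ W.Q ⋙ locF A W hW g :=
  (Localization.Lifting.iso W.Q W (A.F g ⋙ W.Q) (locF A W hW g)).symm

/-- The restriction of `locδ` along the localization functor. -/
noncomputable def locδAux {g h k : G} (e : h * g = k) :
    W.Q ⋙ (locF A W hW h ⋙ locF A W hW g) ≅ W.Q ⋙ locF A W hW k :=
  (Functor.associator _ _ _).symm ≪≫
    Functor.isoWhiskerRight (locIso A W hW h).symm (locF A W hW g) ≪≫
    Functor.associator _ _ _ ≪≫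
    Functor.isoWhiskerLeft (A.F h) (locIso A W hW g).symm ≪≫
    (Functor.associator _ _ _).symm ≪≫
    Functor.isoWhiskerRight (A.δ e) W.Q ≪≫ locIso A W hW k

/-- The isomorphisms induced by `δ` on the localization. -/
noncomputable def locδ {g h k : G} (e : h * g = k) :
    locF A W hW h ⋙ locF A W hW g ≅ locF A W hW k :=
  Localization.liftNatIso W.Q W (W.Q ⋙ (locF A W hW h ⋙ locF A W hW g))
    (W.Q ⋙ locF A W hW k) _ _ (locδAux A W hW e)

lemma whiskerLeft_locδ {g h k : G} (e : h * g = k) :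
    Functor.whiskerLeft W.Q (locδ A W hW e).hom = (locδAux A W hW e).hom := by
  ext X
  refine (Localization.liftNatTrans_app _ _ _ _ _ _ _ _).trans ?_
  exact (Category.id_comp _).trans (Category.comp_id _)

lemma locδ_app {g h k : G} (e : h * g = k) (X : 𝒜) :
    (locδ A W hW e).hom.app (W.Q.obj X) =
      (locF A W hW g).map ((locIso A W hW h).inv.app X) ≫
        (locIso A W hW g).inv.app ((A.F h).obj X) ≫ W.Q.map ((A.δ e).hom.app X) ≫
          (locIso A W hW k).hom.app X := by
  have := NatTrans.congr_app (whiskerLeft_locδ A W hW e) X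
  rw [Functor.whiskerLeft_app] at this
  rw [this]
  simp [locδAux]

/-- Every object of the localization is literally the image of one of 𝒜, where the explicit formula
reduces the claim to the cocycle identity upstairs. -/
lemma locδ_cocycle {g h l hg lh lhg : G} (e₁ : l * h = lh) (e₂ : lh * g = lhg)
    (e₃ : h * g = hg) (e₄ : l * hg = lhg) (X : W.Localization) :
    (locF A W hW g).map ((locδ A W hW e₁).hom.app X) ≫ (locδ A W hW e₂).hom.app X =
      (locδ A W hW e₃).hom.app ((locF A W hW l).obj X) ≫ (locδ A W hW e₄).hom.app X := by
  obtain ⟨X, rfl⟩ : ∃ Y, W.Q.obj Y = X := (Localization.Construction.objEquiv W).surjective X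
  have h₁ := (locδ A W hW e₃).hom.naturality ((locIso A W hW l).inv.app X)
  have h₂ := (locIso A W hW g).inv.naturality ((A.δ e₁).hom.app X)
  have h₃ := A.cocycle e₁ e₂ e₃ e₄ X
  simp only [Functor.comp_map] at h₁ h₂
  have h₄ : (locF A W hW g).map ((locIso A W hW lh).hom.app X) ≫
      (locF A W hW g).map ((locIso A W hW lh).inv.app X) = 𝟙 _ := by
    rw [← Functor.map_comp, Iso.hom_inv_id_app, CategoryTheory.Functor.map_id]
  rw [locδ_app, locδ_app, locδ_app, ← reassoc_of% h₁, locδ_app]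
  simp only [Functor.map_comp, Category.assoc]
  rw [reassoc_of% h₄, reassoc_of% h₂, ← Functor.map_comp_assoc W.Q, h₃, Functor.map_comp_assoc,
    Iso.hom_inv_id_app_assoc]

lemma locIso_comm {g h k : G} (e : h * g = k) (X : 𝒜) :
    W.Q.map ((A.δ e).hom.app X) ≫ (locIso A W hW k).hom.app X =
      (locIso A W hW g).hom.app ((A.F h).obj X) ≫
        (locF A W hW g).map ((locIso A W hW h).hom.app X) ≫
          (locδ A W hW e).hom.app (W.Q.obj X) := by
  have h₁ : (locF A W hW g).map ((locIso A W hW h).hom.app X) ≫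
      (locF A W hW g).map ((locIso A W hW h).inv.app X) = 𝟙 _ := by
    rw [← Functor.map_comp, Iso.hom_inv_id_app, CategoryTheory.Functor.map_id]
  rw [locδ_app, reassoc_of% h₁, Iso.hom_inv_id_app_assoc]

/-- The unit isomorphism on the localization. -/
noncomputable def locOneIso : locF A W hW 1 ≅ 𝟭 W.Localization :=
  Localization.liftNatIso W.Q W (A.F 1 ⋙ W.Q) W.Q _ _
    (Functor.isoWhiskerRight A.oneIso W.Q ≪≫ Functor.leftUnitor _)

/-- The functor of g⁻¹ is a quasi-inverse, through the descended δ and the unit isomorphism. -/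
lemma locF_isEquivalence (g : G) : (locF A W hW g).IsEquivalence :=
  (CategoryTheory.Equivalence.mk (locF A W hW g) (locF A W hW g⁻¹)
    (locδ A W hW (mul_inv_cancel g) ≪≫ locOneIso A W hW).symm
    (locδ A W hW (inv_mul_cancel g) ≪≫ locOneIso A W hW)).isEquivalence_functor

end QuotientAction

/-! ### Existence of an induced admissible action. -/

section Existence

variable {G : Type w} [Group G] {𝒟 : Type u} [Category.{v} 𝒟] [Preadditive 𝒟] [HasShift 𝒟 ℤ]
  [HasZeroObject 𝒟] [∀ n : ℤ, (shiftFunctor 𝒟 n).Additive] [Pretriangulated 𝒟]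
  [IsTriangulated 𝒟] (A : GroupAction G 𝒟) [A.ShiftStructure] [A.IsAdmissible]
  {C : ObjectProperty 𝒟} [C.IsTriangulated]

omit [IsTriangulated 𝒟] [C.IsTriangulated] in
lemma trW_le_inverseImage (hC : A.Invariant C) (g : G) : C.trW ≤ C.trW.inverseImage (A.F g) :=
  fun _ _ _ hs => trW_map_of_le (A.F g) (hC g) hs

variable (hW : ∀ g : G, C.trW ≤ C.trW.inverseImage (A.F g))

omit [A.ShiftStructure] [A.IsAdmissible] in
lemma locF_additive (g : G) : (locF A C.trW hW g).Additive := by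
  rw [Localization.functor_additive_iff C.trW.Q C.trW]
  exact Functor.additive_of_iso (locIso A C.trW hW g)

/-- The action induced on the Verdier quotient. -/
noncomputable def quotientAction : GroupAction G (VerdierQuotient C) where
  F g := locF A C.trW hW g
  isEquivalence g := locF_isEquivalence A C.trW hW g
  additive g := locF_additive A hW g
  δ e := locδ A C.trW hW e
  cocycle e₁ e₂ e₃ e₄ X := locδ_cocycle A C.trW hW e₁ e₂ e₃ e₄ X

noncomputable instance (g : G) : (locF A C.trW hW g).CommShift ℤ :=
  Functor.commShiftOfLocalization (verdierQ C) C.trW ℤ (A.F g ⋙ verdierQ C) _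

instance (g : G) : NatTrans.CommShift (locIso A C.trW hW g).inv ℤ :=
  NatTrans.commShift_iso_hom_of_localization (verdierQ C) C.trW ℤ (A.F g ⋙ verdierQ C) _

instance (g : G) : NatTrans.CommShift (locIso A C.trW hW g).hom ℤ :=
  have : NatTrans.CommShift (locIso A C.trW hW g).symm.hom ℤ :=
    inferInstanceAs (NatTrans.CommShift (locIso A C.trW hW g).inv ℤ)
  NatTrans.CommShift.of_iso_inv (locIso A C.trW hW g).symm ℤ

/-- It is enough to check this after restriction along Q, where the transformation is a composite of
shift-compatible ones. -/
instance {g h k : G} (e : h * g = k) : NatTrans.CommShift (locδ A C.trW hW e).hom ℤ := by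
  have : NatTrans.CommShift (Functor.whiskerLeft C.trW.Q (locδ A C.trW hW e).hom) ℤ := by
    rw [whiskerLeft_locδ]
    dsimp only [locδAux, Iso.trans_hom, Iso.symm_hom, Functor.isoWhiskerRight_hom,
      Functor.isoWhiskerLeft_hom]
    infer_instance
  exact commShift_of_whiskerLeft C.trW.Q C.trW _

lemma locF_isTriangulated (g : G) : (locF A C.trW hW g).IsTriangulated := by
  have : (verdierQ C).mapArrow.EssSurj := Localization.essSurj_mapArrow _ C.trW
  have : NatTrans.CommShift (locIso A C.trW hW g).symm.hom ℤ :=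
    inferInstanceAs (NatTrans.CommShift (locIso A C.trW hW g).inv ℤ)
  exact Functor.isTriangulated_of_precomp_iso (locIso A C.trW hW g).symm

noncomputable instance : (quotientAction A hW).ShiftStructure where
  commShift g := inferInstanceAs ((locF A C.trW hW g).CommShift ℤ)
  commShift_δ e := inferInstanceAs (NatTrans.CommShift (locδ A C.trW hW e).hom ℤ)

/-- The equivariant structure of the quotient functor for the induced action. -/
noncomputable def quotientEquivariantStructure :
    EquivariantStructure A (quotientAction A hW) (verdierQ C) where
  φ g := locIso A C.trW hW g
  comm e X := locIso_comm A C.trW hW e X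

lemma nonempty_inducedAction (hC : A.Invariant C) : Nonempty (InducedAction A C) :=
  have hW := trW_le_inverseImage A hC
  ⟨{ action := quotientAction A hW
     shiftStructure := inferInstance
     isAdmissible := ⟨fun g => locF_isTriangulated A hW g⟩
     equivQ := quotientEquivariantStructure A hW
     commShift_equivQ :=
      ⟨fun g => inferInstanceAs (NatTrans.CommShift (locIso A C.trW hW g).hom ℤ)⟩ }⟩

end Existence

end EquivTri

/-! ### The main theorem. -/

theorem mainTheorem3 {G : Type w} [Group G] [Finite G]
    {𝒟 : Type u} [Category.{v} 𝒟] [Preadditive 𝒟] [HasZeroObject 𝒟] [HasShift 𝒟 ℤ]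
    [∀ n : ℤ, (shiftFunctor 𝒟 n).Additive] [Pretriangulated 𝒟] [IsTriangulated 𝒟]
    -- an admissible action on `𝒟`
    (A : GroupAction G 𝒟) [A.ShiftStructure] [A.IsAdmissible]
    (hG : IsInvertibleIn (Nat.card G : ℤ) 𝒟)
    -- a canonical triangulated structure on `𝒟^G`
    [P : Pretriangulated (Equivariant A)] [IsCanonicalTriangulated A P]
    -- an invariant, strictly full triangulated subcategory
    (C : ObjectProperty 𝒟) [C.IsTriangulated] [C.IsClosedUnderIsomorphisms]
    (hC : A.Invariant C) :
    -- `𝒟/C` carries an induced admissible action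
    Nonempty (InducedAction A C) ∧
    ∀ I : InducedAction A C,
      -- `(𝒟/C)^G` has a unique canonical triangulated structure
      (∃! P' : Pretriangulated (Equivariant I.action), IsCanonicalTriangulated I.action P') ∧
      -- the natural functor `𝒟^G/C^G ⥤ (𝒟/C)^G` is exact
      (∀ P' : Pretriangulated (Equivariant I.action), IsCanonicalTriangulated I.action P' →
        (comparison I).IsTriangulated) ∧
      IsEquivalenceUpToRetracts (comparison I) ∧
      (IsIdempotentComplete (VerdierQuotient (equivariantSubcategory A C)) →
        (comparison I).IsEquivalence) := by
  refine ⟨nonempty_inducedAction A hC, fun I => ⟨existsUnique_isCanonicalTriangulated I hG hC,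
    fun P' hP' => ?_, comparison_isEquivalenceUpToRetracts I hG hC, fun _ =>
      (comparison_isEquivalenceUpToRetracts I hG hC).isEquivalence⟩⟩
  have := hP'.isTriangulated_forget
  exact comparison_isTriangulated I hG
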